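/- **Theorem (bounds on kinetic and potential energy for cohesive dynamics).** Let $d\in\{2,3\}$, let $D\subset\mathbb{R}^d$ be a bounded open set, let $\alpha>0$, put $D_c=\{x\in D:\operatorname{dist}(x,\partial D)<\alpha\}$ and $D_s=D\setminus D_c$, and let $L^2_0(D;\mathbb{R}^d)$ be the space of $u\in L^2(D;\mathbb{R}^d)$ with $u=0$ a.e. on $D_c$, extended by zero to $\mathbb{R}^d$. Let $f:[0,\infty)\to\mathbb{R}$ be smooth and concave, with $f(r)>0$ for $r>0$, $\lim_{r\to0^+}f(r)/r=f'(0)>0$ and $\lim_{r\to\infty}f(r)<\infty$. For each $\varepsilon>0$ let $J^\varepsilon$ be a measurable function with $0\le J^\varepsilon(r)<M$ for $0\le r<\varepsilon$ and $J^\varepsilon(r)=0$ for $r\ge\varepsilon$, where $M$ does not depend on $\varepsilon$. Put $$\mathcal{W}^\varepsilon(S,z)=\frac1\varepsilon J^\varepsilon(|z|)\,\frac{1}{|z|}f(|z|S^2),\qquad S=S(u,x,y)=\frac{u(y)-u(x)}{|y-x|}\cdot\frac{y-x}{|y-x|},$$ let $\mathcal{H}_\varepsilon(x)$ be the ball of radius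 $\varepsilon$ about $x$ and $V_d=\varepsilon^d\omega_d$, with $\omega_d$ the volume of the unit ball, and define $$PD^\varepsilon(u)=\int_D\frac{1}{V_d}\int_{\mathcal{H}_\varepsilon(x)}|y-x|\,\mathcal{W}^\varepsilon(S,y-x)\,dy\,dx,$$ $$\nabla PD^\varepsilon(u)(x)=-\frac{2}{V_d}\int_{\mathcal{H}_\varepsilon(x)}\partial_S\mathcal{W}^\varepsilon(S,y-x)\frac{y-x}{|y-x|}\,dy.$$ Let $\rho>0$, $T>0$ and $b\in C^1([0,T];L^2_0(D;\mathbb{R}^d))$. Let $(u_0,v_0)$ be LEFM initial data: $u_0,v_0\in L^2_0(D;\mathbb{R}^d)$, $u_0\in SBD(D)$, that is, $u_0\in L^1(D;\mathbb{R}^d)$ and the symmetrized distributional gradient of $u_0$ on $D$ is the finite measure $\mathcal{E}u_0\,dx+(u_0^+-u_0^-)\odot\nu\,\mathcal{H}^{d-1}\lfloor J_{u_0}$, where $J_{u_0}$ is the set of points of $D$ at which $u_0$ has two different one-sided Lebesgue limits $u_0^\pm$ with respect to a direction $\nu$, $a\odot\nu=\frac12(a\otimes\nu+\nu\otimes a)$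 and $\mathcal{E}u_0\in L^1(D)$; and $$\int_D\left(2\mu|\mathcal{E}u_0|^2+\lambda|\operatorname{div}u_0|^2\right)dx+\mathcal{G}_c\,\mathcal{H}^{d-1}(J_{u_0})<\infty,\qquad \operatorname{div}u_0=\operatorname{tr}\mathcal{E}u_0,$$ for some constants $\mu,\lambda,\mathcal{G}_c>0$ (finiteness does not depend on their choice). Then there is a constant $C>0$ (for the fixed data above it depends only on $T$), independent of $\varepsilon$, such that for every $\varepsilon$ with $0<2\varepsilon<\alpha$ and every cohesive evolution $u^\varepsilon\in C^2([0,T];L^2_0(D;\mathbb{R}^d))$, i.e. every solution of $$\rho\,u^\varepsilon_{tt}(t)=-\nabla PD^\varepsilon(u^\varepsilon(t))+b(t)\ \text{ a.e. on } D_s,\ 0\le t\le T,\qquad u^\varepsilon(0)=u_0,\quad u^\varepsilon_t(0)=v_0,$$ one has $$\sup_{0\le t\le T}\left\{PD^\varepsilon(u^\varepsilon(t))+\frac{\rho}{2}\|u^\varepsilon_t(t)\|^2_{L^2(D;\mathbb{R}^d)}\right\}\le C.$$ -/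

import Mathlib

open MeasureTheory Filter Topology Set

noncomputable section

namespace CohesiveDynamics

/-- Physical space `ℝᵈ` with the Euclidean norm. -/
abbrev Space (d : ℕ) : Type := EuclideanSpace ℝ (Fin d)

/-! ### The body, its boundary layer, and the space of displacements -/

/-- The constraint set `D_c`: the layer of thickness `α` of points of `D` along its boundary. -/
def constraintSet {d : ℕ} (D : Set (Space d)) (α : ℝ) : Set (Space d) :=
  {x | x ∈ D ∧ Metric.infDist x (frontier D) < α}

/-- The interior part `D_s` of the body, `D = D_c ∪ D_s`. -/
def interiorPart {d : ℕ} (D : Set (Space d)) (α : ℝ) : Set (Space d) :=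
  D \ constraintSet D α

/-- The space `L²₀(D; ℝᵈ)` of square integrable displacements of `D` that vanish (a.e.) on `D_c`.
Its elements are identified with their extensions by zero to all of `ℝᵈ`; the inherited norm is
therefore the norm of `L²(D; ℝᵈ)`. -/
def L20 {d : ℕ} (D : Set (Space d)) (α : ℝ) :
    Submodule ℝ (Lp (Space d) 2 (volume : Measure (Space d))) where
  carrier := {w | ∀ᵐ x, x ∉ interiorPart D α → w x = 0}
  zero_mem' := by
    filter_upwards [Lp.coeFn_zero (Space d) 2 (volume : Measure (Space d))] with x hx _
    rw [hx, Pi.zero_apply]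
  add_mem' := by
    intro v w hv hw
    filter_upwards [hv, hw, Lp.coeFn_add v w] with x h1 h2 h3 hx
    rw [h3, Pi.add_apply, h1 hx, h2 hx, add_zero]
  smul_mem' := by
    intro c w hw
    filter_upwards [hw, Lp.coeFn_smul c w] with x h1 h2 hx
    rw [h2, Pi.smul_apply, h1 hx, smul_zero]

/-- The displacement field `ℝᵈ → ℝᵈ` (a representative) of an element of `L²₀(D; ℝᵈ)`. -/
def field {d : ℕ} {D : Set (Space d)} {α : ℝ} (w : L20 D α) : Space d → Space d :=
  (w : Lp (Space d) 2 (volume : Measure (Space d)))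

/-! ### The cohesive potential and the peridynamic energy -/

/-- Potential functions `f : [0, ∞) → ℝ` (values at negative arguments are irrelevant): positive,
smooth and concave, with `lim_{r → 0⁺} f(r)/r = f'(0) > 0` and a finite limit at infinity. -/
structure IsCohesivePotential (f : ℝ → ℝ) : Prop where
  pos : ∀ r, 0 < r → 0 < f r
  smooth : ContDiffOn ℝ ((⊤ : ℕ∞) : WithTop ℕ∞) f (Ici 0)
  concave : ConcaveOn ℝ (Ici 0) f
  slope_pos : 0 < derivWithin f (Ici 0) 0
  slope : Tendsto (fun r => f r / r) (𝓝[>] 0) (𝓝 (derivWithin f (Ici 0) 0))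
  limit : ∃ fInf : ℝ, Tendsto f atTop (𝓝 fInf)

/-- Influence functions `J^ε`, one for each horizon `ε > 0`, with `0 ≤ J^ε(r) < M` for `0 ≤ r < ε`
and `J^ε(r) = 0` for `r ≥ ε`, with `M` independent of `ε`. -/
structure IsInfluence (J : ℝ → ℝ → ℝ) (M : ℝ) : Prop where
  measurable : ∀ ε, 0 < ε → Measurable (J ε)
  nonneg : ∀ ε, 0 < ε → ∀ r, 0 ≤ r → r < ε → 0 ≤ J ε r
  lt_bound : ∀ ε, 0 < ε → ∀ r, 0 ≤ r → r < ε → J ε r < M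
  eq_zero : ∀ ε, 0 < ε → ∀ r, ε ≤ r → J ε r = 0

/-- The peridynamic potential per unit length, `𝒲^ε(S, z) = ε⁻¹ J^ε(|z|) (|z|⁻¹ f(|z| S²))`. -/
def potentialPerLength {d : ℕ} (f : ℝ → ℝ) (J : ℝ → ℝ → ℝ) (ε S : ℝ) (z : Space d) : ℝ :=
  (1 / ε) * J ε ‖z‖ * ((1 / ‖z‖) * f (‖z‖ * S ^ 2))

/-- The nonlocal potential `W^ε(S, z) = |z| 𝒲^ε(S, z)`. -/
def potential {d : ℕ} (f : ℝ → ℝ) (J : ℝ → ℝ → ℝ) (ε S : ℝ) (z : Space d) : ℝ :=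
  ‖z‖ * potentialPerLength f J ε S z

/-- The force per unit length, `∂_S 𝒲^ε(S, z)`. -/
def forcePerLength {d : ℕ} (f : ℝ → ℝ) (J : ℝ → ℝ → ℝ) (ε S : ℝ) (z : Space d) : ℝ :=
  deriv (fun s : ℝ => potentialPerLength f J ε s z) S

/-- The unit direction `e = (y - x)/|y - x|`. -/
def bond {d : ℕ} (x y : Space d) : Space d := ‖y - x‖⁻¹ • (y - x)

/-- The linearized strain `S = ((u(y) - u(x))/|y - x|) · e`. -/
def strain {d : ℕ} (u : Space d → Space d) (x y : Space d) : ℝ :=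
  inner ℝ (‖y - x‖⁻¹ • (u y - u x)) (bond x y)

/-- `V_d = ε^d ω_d`, with `ω_d` the volume of the unit ball. -/
def neighborhoodVolume (d : ℕ) (ε : ℝ) : ℝ :=
  ε ^ d * (volume : Measure (Space d)).real (Metric.ball 0 1)

/-- The energy density at `x`: `V_d⁻¹ ∫_{H_ε(x)} W^ε(S, y - x) dy`. -/
def energyDensity {d : ℕ} (f : ℝ → ℝ) (J : ℝ → ℝ → ℝ) (ε : ℝ) (u : Space d → Space d)
    (x : Space d) : ℝ :=
  (1 / neighborhoodVolume d ε) * ∫ y in Metric.ball x ε, potential f J ε (strain u x y) (y - x)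

/-- The peridynamic potential energy `PD^ε(u)` of the body `D`. -/
def PD {d : ℕ} (f : ℝ → ℝ) (J : ℝ → ℝ → ℝ) (D : Set (Space d)) (ε : ℝ)
    (u : Space d → Space d) : ℝ :=
  ∫ x in D, energyDensity f J ε u x

/-- `∇PD^ε(u)(x) = -(2/V_d) ∫_{H_ε(x)} ∂_S 𝒲^ε(S, y - x) (y - x)/|y - x| dy`. -/
def gradPD {d : ℕ} (f : ℝ → ℝ) (J : ℝ → ℝ → ℝ) (ε : ℝ) (u : Space d → Space d)
    (x : Space d) : Space d :=
  -((2 / neighborhoodVolume d ε) •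
    ∫ y in Metric.ball x ε, forcePerLength f J ε (strain u x y) (y - x) • bond x y)

/-! ### The initial value problem -/

/-- The velocity `u_t` on `[0, T]` (one-sided at the end points). -/
def velocity {F : Type*} [NormedAddCommGroup F] [NormedSpace ℝ F] (T : ℝ) (u : ℝ → F) : ℝ → F :=
  derivWithin u (Icc 0 T)

/-- `u` is a cohesive evolution: `u ∈ C²([0, T]; L²₀(D; ℝᵈ))` solves
`ρ u_tt = -∇PD^ε(u) + b` with `u(0) = u₀` and `u_t(0) = v₀`.
On the constraint set `D_c` the displacement is prescribed (it is zero, as part of membership in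
`L²₀`), so the equation of motion is imposed at almost every point of `D_s`. -/
structure IsCohesiveEvolution {d : ℕ} (f : ℝ → ℝ) (J : ℝ → ℝ → ℝ) (D : Set (Space d)) (α ρ T : ℝ)
    (b : ℝ → L20 D α) (u₀ v₀ : L20 D α) (ε : ℝ) (u : ℝ → L20 D α) : Prop where
  contDiff : ContDiffOn ℝ 2 u (Icc 0 T)
  displacement_zero : u 0 = u₀
  velocity_zero : velocity T u 0 = v₀
  motion : ∀ t ∈ Icc 0 T, ∀ᵐ x : Space d, x ∈ interiorPart D α →
    ρ • field (velocity T (velocity T u) t) x = -gradPD f J ε (field (u t)) x + field (b t) x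

/-! ### Special functions of bounded deformation and the energy of fracture mechanics -/

/-- `a` is the one-sided Lebesgue limit of `u` at `x`, from the side `(y - x) · ν > 0`. -/
def HasOneSidedLimit {d : ℕ} (u : Space d → Space d) (x ν a : Space d) : Prop :=
  Tendsto (fun r : ℝ => (r ^ d)⁻¹ *
    ∫ y in Metric.ball x r ∩ {y | 0 < inner ℝ (y - x) ν}, ‖u y - a‖) (𝓝[>] 0) (𝓝 0)

/-- `u` jumps at `x` across the unit normal `ν`, with distinct one-sided limits `a` (on the side
`ν` points to) and `c` (on the other side). -/
def HasJump {d : ℕ} (u : Space d → Space d) (x ν a c : Space d) : Prop :=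
  ‖ν‖ = 1 ∧ a ≠ c ∧ HasOneSidedLimit u x ν a ∧ HasOneSidedLimit u x (-ν) c

/-- The jump set `J_u` of `u` in `D`. -/
def jumpSet {d : ℕ} (D : Set (Space d)) (u : Space d → Space d) : Set (Space d) :=
  {x | x ∈ D ∧ ∃ ν a c, HasJump u x ν a c}

/-- The `(d-1)`-dimensional Hausdorff measure, normalized to agree with length and area. -/
def surfaceMeasure (d : ℕ) : Measure (Space d) := Measure.euclideanHausdorffMeasure (d - 1)

/-- The partial derivative `∂_j φ`. -/
def partialDeriv {d : ℕ} (φ : Space d → ℝ) (j : Fin d) (x : Space d) : ℝ :=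
  fderiv ℝ φ x (EuclideanSpace.single j 1)

/-- Entry `(i, j)` of the symmetrized jump tensor `(u⁺ - u⁻) ⊙ ν`. -/
def jumpTensor {d : ℕ} (uPlus uMinus ν : Space d → Space d) (i j : Fin d) (x : Space d) : ℝ :=
  ((uPlus x i - uMinus x i) * ν x j + (uPlus x j - uMinus x j) * ν x i) / 2

/-- `u ∈ SBD(D)` with strain (density of the absolutely continuous part of `Eu`) equal to `e`:
`u ∈ L¹(D; ℝᵈ)`, and the symmetric part of the distributional derivative of `u` is
`Eu = e dx + (u⁺ - u⁻) ⊙ ν ℋ^{d-1}⌊J_u`, a finite measure. -/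
def IsSBDWithStrain {d : ℕ} (D : Set (Space d)) (u : Space d → Space d)
    (e : Space d → Matrix (Fin d) (Fin d) ℝ) : Prop :=
  IntegrableOn u D ∧ (∀ i j, IntegrableOn (fun x => e x i j) D) ∧
  ∃ uPlus uMinus ν : Space d → Space d,
    (∀ x ∈ jumpSet D u, HasJump u x (ν x) (uPlus x) (uMinus x)) ∧
    (∀ i j, IntegrableOn (jumpTensor uPlus uMinus ν i j) (jumpSet D u) (surfaceMeasure d)) ∧
    ∀ φ : Space d → ℝ, ContDiff ℝ ((⊤ : ℕ∞) : WithTop ℕ∞) φ → HasCompactSupport φ →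
      tsupport φ ⊆ D → ∀ i j : Fin d,
      -∫ x in D, (u x i * partialDeriv φ j x + u x j * partialDeriv φ i x) / 2 =
        (∫ x in D, e x i j * φ x) +
          ∫ x in jumpSet D u, jumpTensor uPlus uMinus ν i j x * φ x ∂(surfaceMeasure d)

/-- The energy of linear elastic fracture mechanics
`∫_D (2μ |ℰu|² + λ |div u|²) dx + 𝒢_c ℋ^{d-1}(J_u)` of `u` with strain `ℰu = e`, `div u = tr e`. -/
def LEFM {d : ℕ} (mu lam Gc : ℝ) (D : Set (Space d)) (u : Space d → Space d)
    (e : Space d → Matrix (Fin d) (Fin d) ℝ) : ENNReal :=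
  (∫⁻ x in D, ENNReal.ofReal (2 * mu * ∑ i, ∑ j, (e x i j) ^ 2 + lam * (e x).trace ^ 2)) +
    ENNReal.ofReal Gc * surfaceMeasure d (jumpSet D u)

/-- Initial displacements with finite energy in the sense of linear elastic fracture mechanics. -/
def HasFiniteLEFM {d : ℕ} (mu lam Gc : ℝ) (D : Set (Space d)) (u : Space d → Space d) : Prop :=
  ∃ e : Space d → Matrix (Fin d) (Fin d) ℝ, IsSBDWithStrain D u e ∧ LEFM mu lam Gc D u e < ⊤

end CohesiveDynamics

end

noncomputable section
namespace CohesiveDynamics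

/-! ### Cohesive potentials -/

namespace IsCohesivePotential

variable {f : ℝ → ℝ}

/-! The internal force is minus the gradient of `PD`, so the total energy `PD + ρ/2 ‖u_t‖²` has time
derivative `⟨b, u_t⟩`. By Young's inequality this is at most the energy plus a constant, and
Grönwall's argument bounds the energy on `[0, T]` by its initial value
(`energy_le_of_hasDerivWithinAt`). Two points need work.

Chain rule for `PD`. Since `f` is concave, a bond energy lies below its linearization in the strain
plus a quadratic error. Integrated against the kernel `1/|z|`, integrable for `d ≥ 2`, this makes
`PD` semiconcave on `L²` (`PD_le_semiconcave`). Used in both directions between two times, with the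
force `b - ρ u_tt` continuous in time, semiconcavity alone forces differentiability along the
evolution (`hasDerivWithinAt_of_semiconcave`). Its constant depends on `ε` but does not enter the
energy bound.

Initial energy, uniformly in `ε` (`exists_PD_bound`). Fix a bond vector `z`. If the segment from `x`
to `x + z` misses the jump set, the increment of `u · z` is the integral along it of the strain
contracted with `z ⊗ z`; then `f(r) ≤ f'(0) r` gives a contribution of order `|z| ∫ |ℰu|²`. The
remaining `x` form a tube of volume at most `c |z| ℋ^{d-1}(J_u)` (`exists_volume_tube_le`), where
`f` is bounded. Both parts are of order `|z| < ε` and absorb the prefactor `1/ε`. The increment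
formula needs no slicing: it comes from averaging the weak identity over translated test functions
(`ae_difference_eq_integral`). -/

theorem continuousOn (hf : IsCohesivePotential f) : ContinuousOn f (Ici 0) :=
  hf.smooth.continuousOn

theorem hasDerivWithinAt (hf : IsCohesivePotential f) {r : ℝ} (hr : 0 ≤ r) :
    HasDerivWithinAt f (derivWithin f (Ici 0) r) (Ici 0) r :=
  ((hf.smooth.differentiableOn (by simp)) r hr).hasDerivWithinAt

theorem continuousOn_derivWithin (hf : IsCohesivePotential f) :
    ContinuousOn (derivWithin f (Ici 0)) (Ici 0) :=
  hf.smooth.continuousOn_derivWithin (uniqueDiffOn_Ici 0) (by simp)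

/-- The value at `0` is forced: `f(r) = (f(r)/r) r` tends to `f'(0) · 0`. -/
theorem map_zero (hf : IsCohesivePotential f) : f 0 = 0 := by
  have h1 : Tendsto f (𝓝[>] 0) (𝓝 (f 0)) :=
    (hf.continuousOn 0 self_mem_Ici).mono_left (nhdsWithin_mono _ Ioi_subset_Ici_self)
  have h2 : Tendsto (fun r => f r / r * r) (𝓝[>] 0)
      (𝓝 (derivWithin f (Ici 0) 0 * 0)) :=
    hf.slope.mul (tendsto_id.mono_left nhdsWithin_le_nhds)
  rw [mul_zero] at h2
  refine tendsto_nhds_unique h1 (h2.congr' ?_)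
  filter_upwards [self_mem_nhdsWithin] with r hr
  exact div_mul_cancel₀ _ (ne_of_gt hr)

theorem nonneg (hf : IsCohesivePotential f) {r : ℝ} (hr : 0 ≤ r) : 0 ≤ f r := by
  rcases hr.eq_or_lt with rfl | h
  · rw [hf.map_zero]
  · exact (hf.pos r h).le

theorem le_tangent (hf : IsCohesivePotential f) {r s : ℝ} (hr : 0 ≤ r) (hs : 0 ≤ s) :
    f s ≤ f r + derivWithin f (Ici 0) r * (s - r) := by
  have hd := (hf.hasDerivWithinAt hr).differentiableWithinAt
  rcases lt_trichotomy r s with h | h | h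
  · have := hf.concave.slope_le_derivWithin hr hs h hd
    rw [slope_def_field, div_le_iff₀ (sub_pos.2 h)] at this
    linarith
  · simp [h]
  · have := hf.concave.derivWithin_le_slope hs hr h hd
    rw [slope_def_field, le_div_iff₀ (sub_pos.2 h)] at this
    linarith

theorem derivWithin_nonneg (hf : IsCohesivePotential f) {r : ℝ} (hr : 0 ≤ r) :
    0 ≤ derivWithin f (Ici 0) r := by
  by_contra! h
  set k := derivWithin f (Ici 0) r
  -- At this point the tangent line with negative slope `k` takes the value `-1`, yet it dominates
  -- `f ≥ 0`.
  have hs : 0 ≤ r + (f r + 1) / (-k) :=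
    add_nonneg hr (div_nonneg (by linarith [hf.nonneg hr]) (by linarith))
  have h1 := hf.le_tangent hr hs
  have h2 := hf.nonneg hs
  have h3 : k * (r + (f r + 1) / (-k) - r) = -(f r + 1) := by
    have : k ≠ 0 := h.ne
    field_simp
    ring
  change _ ≤ f r + k * _ at h1
  linarith

theorem derivWithin_le (hf : IsCohesivePotential f) {r : ℝ} (hr : 0 ≤ r) :
    derivWithin f (Ici 0) r ≤ derivWithin f (Ici 0) 0 := by
  rcases hr.eq_or_lt with rfl | h
  · rfl
  · have h1 := hf.le_tangent hr le_rfl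
    have h2 := hf.le_tangent le_rfl hr
    refine le_of_mul_le_mul_right ?_ h
    linarith

theorem le_linear (hf : IsCohesivePotential f) {r : ℝ} (hr : 0 ≤ r) :
    f r ≤ derivWithin f (Ici 0) 0 * r := by
  have := hf.le_tangent le_rfl hr
  rw [hf.map_zero] at this
  linarith

/-- `f` is nondecreasing, its derivative being nonnegative, so its limit at infinity is an upper
bound. -/
theorem exists_bound (hf : IsCohesivePotential f) : ∃ B, 0 < B ∧ ∀ r, 0 ≤ r → f r ≤ B := by
  obtain ⟨l, hl⟩ := hf.limit
  have key : ∀ r, 0 ≤ r → f r ≤ l := fun r hr => by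
    refine ge_of_tendsto hl ?_
    filter_upwards [eventually_ge_atTop r] with s hs
    have h1 := hf.le_tangent (hr.trans hs) hr
    nlinarith [hf.derivWithin_nonneg (hr.trans hs)]
  exact ⟨l, (hf.pos 1 one_pos).trans_le (key 1 zero_le_one), key⟩

end IsCohesivePotential

/-! ### Influence functions and the pointwise semiconcavity of the bond energy -/

variable {d : ℕ} {f : ℝ → ℝ} {J : ℝ → ℝ → ℝ} {M : ℝ}

theorem IsInfluence.bound_pos (hJ : IsInfluence J M) : 0 < M :=
  (hJ.nonneg 1 one_pos 0 le_rfl one_pos).trans_lt (hJ.lt_bound 1 one_pos 0 le_rfl one_pos)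

theorem IsInfluence.nonneg' (hJ : IsInfluence J M) {ε r : ℝ} (hε : 0 < ε) (hr : 0 ≤ r) :
    0 ≤ J ε r := by
  rcases lt_or_ge r ε with h | h
  · exact hJ.nonneg ε hε r hr h
  · rw [hJ.eq_zero ε hε r h]

theorem IsInfluence.le_bound (hJ : IsInfluence J M) {ε r : ℝ} (hε : 0 < ε) (hr : 0 ≤ r) :
    J ε r ≤ M := by
  rcases lt_or_ge r ε with h | h
  · exact (hJ.lt_bound ε hε r hr h).le
  · rw [hJ.eq_zero ε hε r h]; exact hJ.bound_pos.le

theorem potential_eq (hf : IsCohesivePotential f) (ε S : ℝ) (z : Space d) :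
    potential f J ε S z = 1 / ε * J ε ‖z‖ * f (‖z‖ * S ^ 2) := by
  unfold potential potentialPerLength
  rcases eq_or_ne z 0 with rfl | hz
  · simp [hf.map_zero]
  · have := norm_ne_zero_iff.2 hz
    field_simp

/-- The factor `‖z‖⁻¹ * ‖z‖` is left uncancelled so that the formula also covers `z = 0`, where both
sides vanish. The one-sided derivative of `f` suffices because `s ↦ ‖z‖ s²` takes values in `[0,
∞)`. -/
theorem forcePerLength_eq (hf : IsCohesivePotential f) (ε S : ℝ) (z : Space d) :
    forcePerLength f J ε S z =
      1 / ε * J ε ‖z‖ * (2 * derivWithin f (Ici 0) (‖z‖ * S ^ 2) * (‖z‖⁻¹ * ‖z‖ * S)) := by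
  have h1 : HasDerivAt (fun s : ℝ => f (‖z‖ * s ^ 2))
      (derivWithin f (Ici 0) (‖z‖ * S ^ 2) * (‖z‖ * (2 * S))) S := by
    have h2 : HasDerivWithinAt (fun s : ℝ => ‖z‖ * s ^ 2) (‖z‖ * (2 * S)) univ S := by
      have := ((hasDerivAt_pow 2 S).const_mul ‖z‖).hasDerivWithinAt (s := univ)
      simpa using this
    have h3 := (hf.hasDerivWithinAt (r := ‖z‖ * S ^ 2) (by positivity)).comp S h2
      (fun s _ => by simp only [mem_Ici]; positivity)
    exact hasDerivWithinAt_univ.1 h3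
  have h4 := (h1.const_mul (1 / ‖z‖)).const_mul (1 / ε * J ε ‖z‖)
  unfold forcePerLength
  rw [show (fun s : ℝ => potentialPerLength f J ε s z) =
    fun s => 1 / ε * J ε ‖z‖ * (1 / ‖z‖ * f (‖z‖ * s ^ 2)) from rfl, h4.deriv]
  ring

theorem potential_nonneg (hf : IsCohesivePotential f) (hJ : IsInfluence J M) {ε : ℝ} (hε : 0 < ε)
    (S : ℝ) (z : Space d) : 0 ≤ potential f J ε S z := by
  rw [potential_eq hf]
  have := hJ.nonneg' hε (norm_nonneg z)
  have := hf.nonneg (r := ‖z‖ * S ^ 2) (by positivity)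
  positivity

/-- The potential is semiconcave in the strain. -/
theorem potential_le (hf : IsCohesivePotential f) (hJ : IsInfluence J M) {ε : ℝ} (hε : 0 < ε)
    (S s : ℝ) (z : Space d) :
    potential f J ε (S + s) z ≤ potential f J ε S z + forcePerLength f J ε S z * (‖z‖ * s) +
      1 / ε * M * derivWithin f (Ici 0) 0 * (‖z‖ * s ^ 2) := by
  rw [potential_eq hf, potential_eq hf, forcePerLength_eq hf]
  set k := derivWithin f (Ici 0) (‖z‖ * S ^ 2) with hk
  have hz : ‖z‖⁻¹ * ‖z‖ * ‖z‖ = ‖z‖ := by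
    rcases eq_or_ne z 0 with rfl | hz
    · simp
    · rw [inv_mul_cancel₀ (norm_ne_zero_iff.2 hz), one_mul]
  have hn : 0 ≤ ‖z‖ * S ^ 2 := by positivity
  -- The argument of `f` moves by `2‖z‖Ss + ‖z‖s²`: the first term gives the force, the second is
  -- the quadratic error, with coefficient `k ≤ f'(0)`.
  have h1 := hf.le_tangent hn (s := ‖z‖ * (S + s) ^ 2) (by positivity)
  have hk0 := hf.derivWithin_nonneg hn
  have hk1 := hf.derivWithin_le hn
  have hJ0 := hJ.nonneg' hε (norm_nonneg z)
  have hJ1 := hJ.le_bound hε (norm_nonneg z)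
  have hM := hJ.bound_pos
  rw [← hk] at h1 hk0 hk1
  have hε' : 0 < 1 / ε := by positivity
  have h2 : 1 / ε * J ε ‖z‖ * f (‖z‖ * (S + s) ^ 2) ≤
      1 / ε * J ε ‖z‖ * (f (‖z‖ * S ^ 2) + k * (‖z‖ * (S + s) ^ 2 - ‖z‖ * S ^ 2)) :=
    mul_le_mul_of_nonneg_left h1 (by positivity)
  have h3 : 1 / ε * J ε ‖z‖ * k * (‖z‖ * s ^ 2) ≤
      1 / ε * M * derivWithin f (Ici 0) 0 * (‖z‖ * s ^ 2) := by gcongr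
  have h4 : 1 / ε * J ε ‖z‖ * (2 * k * (‖z‖⁻¹ * ‖z‖ * S)) * (‖z‖ * s) =
      1 / ε * J ε ‖z‖ * (2 * k * S * s * (‖z‖⁻¹ * ‖z‖ * ‖z‖)) := by ring
  rw [h4, hz]
  nlinarith

end CohesiveDynamics
end
-- Volume of the tube swept by a set under translation
noncomputable section
namespace CohesiveDynamics
variable {d : ℕ}

/-- The points from which a translation by at most `z` hits `A`. -/
def tube (A : Set (Space d)) (z : Space d) : Set (Space d) :=
  {x | ∃ t ∈ Icc (0 : ℝ) 1, x + t • z ∈ A}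

/-- Rounding `t` down to a multiple `k/N` moves the point by at most `‖z‖/N ≤ δ`, which doubles the
radius. -/
theorem tube_subset_iUnion_ball {A : Set (Space d)} {p z : Space d} {δ : ℝ} (hδ : 0 < δ)
    (hA : A ⊆ Metric.closedBall p δ) (N : ℕ) (hN : 0 < N) (hz : ‖z‖ ≤ N * δ) :
    tube A z ⊆ ⋃ k ∈ Finset.range (N + 1),
      Metric.closedBall (p - ((k : ℝ) / N) • z) (2 * δ) := by
  rintro x ⟨t, ⟨ht0, ht1⟩, hx⟩
  have hN' : (0 : ℝ) < N := by exact_mod_cast hN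
  have hk : ⌊t * N⌋₊ < N + 1 := by
    rw [Nat.floor_lt (by positivity)]
    push_cast
    nlinarith
  simp only [mem_iUnion, Finset.mem_range]
  refine ⟨⌊t * N⌋₊, hk, ?_⟩
  have h1 := Nat.floor_le (show 0 ≤ t * N by positivity)
  have h2 := Nat.lt_floor_add_one (t * N)
  set k : ℝ := (⌊t * N⌋₊ : ℝ)
  have h3 : |k / N - t| ≤ 1 / N := by
    rw [abs_le]
    constructor
    · rw [← sub_nonneg]
      have : k / N - t - -(1 / N) = (k + 1 - t * N) / N := by field_simp; ring
      rw [this]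
      exact div_nonneg (by linarith) hN'.le
    · rw [sub_le_iff_le_add, div_le_iff₀ hN']
      have : (1 / (N : ℝ) + t) * N = 1 + t * N := by field_simp
      rw [this]
      linarith
  have h4 := Metric.mem_closedBall.1 (hA hx)
  rw [dist_eq_norm] at h4
  rw [Metric.mem_closedBall, dist_eq_norm]
  calc ‖x - (p - (k / N) • z)‖ = ‖(x + t • z - p) + (k / N - t) • z‖ := by
        congr 1; module
    _ ≤ ‖x + t • z - p‖ + |k / N - t| * ‖z‖ := by
        refine (norm_add_le _ _).trans ?_
        rw [norm_smul, Real.norm_eq_abs]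
    _ ≤ δ + 1 / N * (N * δ) := by gcongr
    _ = 2 * δ := by field_simp; ring

/-- The constant in the volume bound for tubes. -/
def tubeConst (d : ℕ) : ℝ := 2 ^ d * (volume : Measure (Space d)).real (Metric.ball 0 1)

theorem tubeConst_nonneg (d : ℕ) : 0 ≤ tubeConst d := by unfold tubeConst; positivity

theorem volume_tube_le_of_subset_closedBall {A : Set (Space d)} {p z : Space d} {δ : ℝ}
    (hδ : 0 < δ) (hA : A ⊆ Metric.closedBall p δ) :
    volume (tube A z) ≤ ENNReal.ofReal (tubeConst d * (‖z‖ / δ + 3) * δ ^ d) := by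
  -- The extra `1` keeps `N` positive when `z = 0`; the number of balls is then at most `‖z‖/δ + 3`.
  set N : ℕ := ⌈‖z‖ / δ⌉₊ + 1
  have hN : ‖z‖ / δ ≤ ⌈‖z‖ / δ⌉₊ := Nat.le_ceil _
  have hz : ‖z‖ ≤ N * δ := by
    rw [← div_le_iff₀ hδ]
    push_cast [N]
    linarith
  have hN2 : ((N + 1 : ℕ) : ℝ) ≤ ‖z‖ / δ + 3 := by
    have := Nat.ceil_lt_add_one (show 0 ≤ ‖z‖ / δ by positivity)
    push_cast [N]
    linarith
  have hb : ∀ c : Space d, volume (Metric.closedBall c (2 * δ)) =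
      ENNReal.ofReal (tubeConst d * δ ^ d) := fun c => by
    rw [Measure.addHaar_closedBall _ _ (by positivity), finrank_euclideanSpace, Fintype.card_fin,
      ← ENNReal.ofReal_toReal (measure_ball_lt_top (μ := volume) (x := (0 : Space d)) (r := 1)).ne,
      ← ENNReal.ofReal_mul (by positivity)]
    congr 1
    simp only [tubeConst, Measure.real]
    ring
  calc volume (tube A z)
      ≤ volume (⋃ k ∈ Finset.range (N + 1),
        Metric.closedBall (p - ((k : ℝ) / N) • z) (2 * δ)) :=
        measure_mono (tube_subset_iUnion_ball hδ hA N (Nat.succ_pos _) hz)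
    _ ≤ ∑ k ∈ Finset.range (N + 1), volume (Metric.closedBall (p - ((k : ℝ) / N) • z) (2 * δ)) :=
        measure_biUnion_finset_le _ _
    _ = ENNReal.ofReal (((N + 1 : ℕ) : ℝ) * (tubeConst d * δ ^ d)) := by
        simp only [hb, Finset.sum_const, Finset.card_range, nsmul_eq_mul]
        rw [ENNReal.ofReal_mul (Nat.cast_nonneg (N + 1)), ENNReal.ofReal_natCast]
    _ ≤ _ := by
        apply ENNReal.ofReal_le_ofReal
        have := tubeConst_nonneg d
        refine (mul_le_mul_of_nonneg_right hN2 (by positivity)).trans_eq ?_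
        ring

theorem volume_tube_le_ediam (hd : 2 ≤ d) {A : Set (Space d)} {z : Space d} (hA : A.Nonempty)
    (hAz : Metric.ediam A ≤ ENNReal.ofReal ‖z‖) :
    volume (tube A z) ≤
      ENNReal.ofReal (4 * tubeConst d * ‖z‖) * Metric.ediam A ^ ((d - 1 : ℕ) : ℝ) := by
  obtain ⟨p, hp⟩ := hA
  have hfin : Metric.ediam A ≠ ⊤ := ne_top_of_le_ne_top ENNReal.ofReal_ne_top hAz
  have hbdd : Bornology.IsBounded A := Metric.isBounded_iff_ediam_ne_top.2 hfin
  set r := Metric.diam A with hr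
  have hr0 : 0 ≤ r := Metric.diam_nonneg
  have hrz : r ≤ ‖z‖ := ENNReal.toReal_le_of_le_ofReal (norm_nonneg _) hAz
  have hsub : ∀ δ, r ≤ δ → A ⊆ Metric.closedBall p δ := fun δ hδ x hx =>
    (Metric.dist_le_diam_of_mem hbdd hx hp).trans hδ
  have hE : Metric.ediam A = ENNReal.ofReal r := (ENNReal.ofReal_toReal hfin).symm
  obtain ⟨n, rfl⟩ : ∃ n, d = n + 1 := ⟨d - 1, by omega⟩
  have hn : n ≠ 0 := by omega
  rw [hE, ENNReal.rpow_natCast, Nat.add_sub_cancel, ← ENNReal.ofReal_pow hr0,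
    ← ENNReal.ofReal_mul (by have := tubeConst_nonneg (n + 1); positivity)]
  -- The diameter `r` may be zero while the covering needs a positive radius, so the bound is taken
  -- for `δ > r` and `δ` decreases to `r`. The constant `4` then comes from `‖z‖ + 3r ≤ 4‖z‖`.
  have hlim : Tendsto (fun δ : ℝ =>
      ENNReal.ofReal (tubeConst (n + 1) * (‖z‖ + 3 * δ) * δ ^ n)) (𝓝[>] r)
      (𝓝 (ENNReal.ofReal (tubeConst (n + 1) * (‖z‖ + 3 * r) * r ^ n))) := by
    refine ENNReal.tendsto_ofReal (Tendsto.mono_left ?_ nhdsWithin_le_nhds)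
    exact Continuous.tendsto (by fun_prop) r
  have h1 : volume (tube A z) ≤
      ENNReal.ofReal (tubeConst (n + 1) * (‖z‖ + 3 * r) * r ^ n) := by
    refine ge_of_tendsto hlim ?_
    filter_upwards [self_mem_nhdsWithin] with δ hδ
    have hδ0 : 0 < δ := hr0.trans_lt hδ
    refine (volume_tube_le_of_subset_closedBall hδ0 (hsub δ (le_of_lt hδ))).trans_eq ?_
    congr 1
    field_simp
    ring
  refine h1.trans (ENNReal.ofReal_le_ofReal ?_)
  have := tubeConst_nonneg (n + 1)
  rw [mul_comm 4, mul_assoc _ 4]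
  gcongr
  linarith

/-- The tube of a countable cover is the union of the tubes of its pieces. For pieces of diameter at
most `‖z‖` each tube is bounded by the corresponding term of the Hausdorff sum, so the premeasure at
the single scale `‖z‖` suffices. -/
theorem volume_tube_le_hausdorffMeasure (hd : 2 ≤ d) (A : Set (Space d)) {z : Space d}
    (hz : z ≠ 0) :
    volume (tube A z) ≤
      ENNReal.ofReal (4 * tubeConst d * ‖z‖) * Measure.hausdorffMeasure ((d - 1 : ℕ) : ℝ) A := by
  have hc : ENNReal.ofReal (4 * tubeConst d * ‖z‖) ≠ 0 := by
    have : 0 < tubeConst d := by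
      unfold tubeConst
      have : 0 < (volume : Measure (Space d)).real (Metric.ball 0 1) :=
        ENNReal.toReal_pos (Metric.measure_ball_pos _ _ one_pos).ne' measure_ball_lt_top.ne
      positivity
    have := norm_pos_iff.2 hz
    simp only [ne_eq, ENNReal.ofReal_eq_zero, not_le]
    positivity
  rw [mul_comm, ← ENNReal.div_le_iff_le_mul (Or.inl hc) (Or.inl ENNReal.ofReal_ne_top),
    Measure.hausdorffMeasure_apply]
  refine le_trans ?_ (le_iSup₂ (ENNReal.ofReal ‖z‖)
    (ENNReal.ofReal_pos.2 (norm_pos_iff.2 hz)))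
  refine le_iInf fun t => le_iInf fun hst => le_iInf fun ht => ?_
  rw [ENNReal.div_le_iff_le_mul (Or.inl hc) (Or.inl ENNReal.ofReal_ne_top), mul_comm,
    ← ENNReal.tsum_mul_left]
  have hsub : tube A z ⊆ ⋃ n, tube (t n) z := by
    rintro x ⟨s, hs, hx⟩
    obtain ⟨n, hn⟩ := mem_iUnion.1 (hst hx)
    exact mem_iUnion.2 ⟨n, s, hs, hn⟩
  refine (measure_mono hsub).trans ((measure_iUnion_le _).trans (ENNReal.tsum_le_tsum fun n => ?_))
  by_cases hne : (t n).Nonempty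
  · simp only [hne, iSup_pos]
    exact volume_tube_le_ediam hd hne (ht n)
  · have : tube (t n) z = ∅ := by
      rw [not_nonempty_iff_eq_empty.1 hne]
      ext x
      simp [tube]
    simp [this]

/-- The normalized surface measure is a nonzero multiple of the Hausdorff measure, so only the
constant changes. -/
theorem exists_volume_tube_le (hd : 2 ≤ d) :
    ∃ c : ENNReal, c ≠ ⊤ ∧ ∀ (A : Set (Space d)) (z : Space d), z ≠ 0 →
      volume (tube A z) ≤ c * ENNReal.ofReal ‖z‖ * surfaceMeasure d A := by
  set k := Measure.addHaarScalarFactor (volume : Measure (Space (d - 1)))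
    (Measure.hausdorffMeasure ((d - 1 : ℕ) : ℝ)) with hk
  have hk0 : (k : ENNReal) ≠ 0 := by
    simpa [hk] using Measure.addHaarScalarFactor_volume_hausdorffMeasure_ne_zero (d - 1)
  refine ⟨ENNReal.ofReal (4 * tubeConst d) * (k : ENNReal)⁻¹,
    ENNReal.mul_ne_top ENNReal.ofReal_ne_top (ENNReal.inv_ne_top.2 hk0), fun A z hz => ?_⟩
  refine (volume_tube_le_hausdorffMeasure hd A hz).trans_eq ?_
  have h1 : surfaceMeasure d A =
      (k : ENNReal) * Measure.hausdorffMeasure ((d - 1 : ℕ) : ℝ) A := by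
    simp only [surfaceMeasure, Measure.euclideanHausdorffMeasure_def, Measure.smul_apply, ← hk]
    rfl
  rw [h1, ENNReal.ofReal_mul (by have := tubeConst_nonneg d; positivity)]
  rw [show ENNReal.ofReal (4 * tubeConst d) * (k : ENNReal)⁻¹ * ENNReal.ofReal ‖z‖ *
    ((k : ENNReal) * Measure.hausdorffMeasure ((d - 1 : ℕ) : ℝ) A) =
    ENNReal.ofReal (4 * tubeConst d) * ENNReal.ofReal ‖z‖ *
    Measure.hausdorffMeasure ((d - 1 : ℕ) : ℝ) A * ((k : ENNReal)⁻¹ * k) by ring,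
    ENNReal.inv_mul_cancel hk0 ENNReal.coe_ne_top, mul_one]

end CohesiveDynamics
end
-- Measures determined by smooth test functions
noncomputable section
namespace CohesiveDynamics

section TestFunctions

variable {E : Type*} [NormedAddCommGroup E] [NormedSpace ℝ E] [FiniteDimensional ℝ E]
  [MeasurableSpace E] [BorelSpace E]

/-- Reduction to the fundamental lemma of the calculus of variations for the densities with respect
to a common dominating measure. -/
theorem rnDeriv_ae_eq_of_forall_integral_contDiff_eq {μ ν κ : Measure E} [IsFiniteMeasure μ]
    [IsFiniteMeasure ν] [IsFiniteMeasure κ] (hμ : μ ≪ κ) (hν : ν ≪ κ)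
    (h : ∀ g : E → ℝ, ContDiff ℝ ((⊤ : ℕ∞) : WithTop ℕ∞) g → HasCompactSupport g →
      ∫ x, g x ∂μ = ∫ x, g x ∂ν) :
    ∀ᵐ x ∂κ, (μ.rnDeriv κ x).toReal = (ν.rnDeriv κ x).toReal := by
  have i1 : LocallyIntegrable (fun x => (μ.rnDeriv κ x).toReal) κ :=
    Measure.integrable_toReal_rnDeriv.locallyIntegrable
  have i2 : LocallyIntegrable (fun x => (ν.rnDeriv κ x).toReal) κ :=
    Measure.integrable_toReal_rnDeriv.locallyIntegrable
  refine ae_eq_of_integral_contDiff_smul_eq i1 i2 fun g hg hg' => ?_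
  simp only [smul_eq_mul, mul_comm (g _)]
  simp only [← smul_eq_mul]
  rw [integral_rnDeriv_smul hμ, integral_rnDeriv_smul hν]
  exact h g hg hg'

/-- Finite measures with the same integrals against test functions are equal. -/
theorem ext_of_forall_integral_contDiff_eq {μ ν : Measure E} [IsFiniteMeasure μ]
    [IsFiniteMeasure ν]
    (h : ∀ g : E → ℝ, ContDiff ℝ ((⊤ : ℕ∞) : WithTop ℕ∞) g → HasCompactSupport g →
      ∫ x, g x ∂μ = ∫ x, g x ∂ν) : μ = ν := by
  obtain ⟨κ, hκ, hμ, hν⟩ : ∃ κ : Measure E, IsFiniteMeasure κ ∧ μ ≪ κ ∧ ν ≪ κ :=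
    ⟨μ + ν, inferInstance, Measure.absolutelyContinuous_of_le (Measure.le_add_right le_rfl),
      Measure.absolutelyContinuous_of_le (Measure.le_add_left le_rfl)⟩
  have key := rnDeriv_ae_eq_of_forall_integral_contDiff_eq hμ hν h
  rw [← Measure.withDensity_rnDeriv_eq μ κ hμ, ← Measure.withDensity_rnDeriv_eq ν κ hν]
  refine withDensity_congr_ae ?_
  filter_upwards [key, Measure.rnDeriv_lt_top μ κ, Measure.rnDeriv_lt_top ν κ]
    with x hx h1 h2
  exact (ENNReal.toReal_eq_toReal_iff' h1.ne h2.ne).1 hx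

theorem integral_withDensity_ofReal {X : Type*} [MeasurableSpace X] {m : Measure X} {q : X → ℝ}
    (hq : AEMeasurable q m) (g : X → ℝ) :
    ∫ x, g x ∂(m.withDensity fun x => ENNReal.ofReal (q x)) = ∫ x, g x * max (q x) 0 ∂m := by
  rw [integral_withDensity_eq_integral_toReal_smul₀ hq.ennreal_ofReal
    (Eventually.of_forall fun _ => ENNReal.ofReal_lt_top)]
  simp only [ENNReal.toReal_ofReal', smul_eq_mul, mul_comm]

/-- A function whose pairing with test functions is given by a signed measure vanishes almost
everywhere on the sets which are null for that measure. -/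
theorem ae_eq_zero_of_integral_test_eq {X : Type*} [MeasurableSpace X] {μ : Measure E}
    [SigmaFinite μ] {m : Measure X} {q : E → ℝ} {θ : X → ℝ} {τ : X → E} (hq : Integrable q μ)
    (hθ : Integrable θ m) (hτ : Measurable τ)
    (h : ∀ g : E → ℝ, ContDiff ℝ ((⊤ : ℕ∞) : WithTop ℕ∞) g → HasCompactSupport g →
      ∫ x, g x * q x ∂μ = ∫ p, g (τ p) * θ p ∂m)
    {B : Set E} (hB : MeasurableSet B) (hBm : m (τ ⁻¹' B) = 0) :
    ∀ᵐ x ∂μ, x ∈ B → q x = 0 := by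
  have fin : ∀ {Y : Type _} [MeasurableSpace Y] {k : Measure Y} {w : Y → ℝ}, Integrable w k →
      IsFiniteMeasure (k.withDensity fun x => ENNReal.ofReal (w x)) := fun hw =>
    isFiniteMeasure_withDensity_ofReal hw.2
  have finX : ∀ {w : X → ℝ}, Integrable w m →
      IsFiniteMeasure (m.withDensity fun x => ENNReal.ofReal (w x)) := fun hw =>
    isFiniteMeasure_withDensity_ofReal hw.2
  let mp : ℝ → Measure E := fun s => μ.withDensity fun x => ENNReal.ofReal (s * q x)
  let nu : ℝ → Measure X := fun s => m.withDensity fun p => ENNReal.ofReal (s * θ p)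
  have i1 : ∀ s, IsFiniteMeasure (mp s) := fun s => fin (hq.const_mul s)
  have i2 : ∀ s, IsFiniteMeasure (nu s) := fun s => finX (hθ.const_mul s)
  -- Positive and negative parts are moved to opposite sides, so that the identity of signed
  -- measures becomes one between finite positive measures: `q⁺μ + τ_*(θ⁻m) = q⁻μ + τ_*(θ⁺m)`.
  have heq : mp 1 + (nu (-1)).map τ = mp (-1) + (nu 1).map τ := by
    refine ext_of_forall_integral_contDiff_eq fun g hg hgc => ?_
    obtain ⟨C, hC⟩ := hgc.exists_bound_of_continuous hg.continuous
    have hgm := hg.continuous.measurable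
    have ig : ∀ k : Measure E, IsFiniteMeasure k → Integrable g k := fun k _ =>
      Integrable.of_bound hgm.aestronglyMeasurable C (Eventually.of_forall hC)
    have e1 : ∀ s, ∫ x, g x ∂(mp s) = ∫ x, g x * max (s * q x) 0 ∂μ := fun s =>
      integral_withDensity_ofReal (hq.const_mul s).aemeasurable g
    have e2 : ∀ s, ∫ x, g x ∂((nu s).map τ) = ∫ p, g (τ p) * max (s * θ p) 0 ∂m := fun s => by
      rw [integral_map hτ.aemeasurable hgm.aestronglyMeasurable]
      exact integral_withDensity_ofReal (hθ.const_mul s).aemeasurable _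
    have j1 : ∀ s, Integrable (fun x => g x * max (s * q x) 0) μ := fun s =>
      (hq.const_mul s).pos_part.bdd_mul hgm.aestronglyMeasurable (Eventually.of_forall hC)
    have j2 : ∀ s, Integrable (fun p => g (τ p) * max (s * θ p) 0) m := fun s =>
      (hθ.const_mul s).pos_part.bdd_mul (hgm.comp hτ).aestronglyMeasurable
        (Eventually.of_forall fun p => hC _)
    rw [integral_add_measure (ig _ inferInstance) (ig _ inferInstance),
      integral_add_measure (ig _ inferInstance) (ig _ inferInstance), e1, e1, e2, e2]
    have k1 : ∫ x, g x * q x ∂μ =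
        ∫ x, g x * max (1 * q x) 0 ∂μ - ∫ x, g x * max (-1 * q x) 0 ∂μ := by
      rw [← integral_sub (j1 1) (j1 (-1))]
      refine integral_congr_ae (Eventually.of_forall fun x => ?_)
      simp only [one_mul, neg_mul, ← mul_sub]
      rw [max_zero_sub_max_neg_zero_eq_self]
    have k2 : ∫ p, g (τ p) * θ p ∂m =
        ∫ p, g (τ p) * max (1 * θ p) 0 ∂m - ∫ p, g (τ p) * max (-1 * θ p) 0 ∂m := by
      rw [← integral_sub (j2 1) (j2 (-1))]
      refine integral_congr_ae (Eventually.of_forall fun x => ?_)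
      simp only [one_mul, neg_mul, ← mul_sub]
      rw [max_zero_sub_max_neg_zero_eq_self]
    have := h g hg hgc
    linarith
  have hnull : ∀ s, (nu s) (τ ⁻¹' B) = 0 := fun s => withDensity_absolutelyContinuous _ _ hBm
  -- On `B` the pushforwards vanish, leaving `q⁺ = q⁻` almost everywhere there, that is `q = 0`.
  have hres : (mp 1).restrict B = (mp (-1)).restrict B := by
    have h0 : ∀ s, ((nu s).map τ).restrict B = 0 := fun s => by
      rw [Measure.restrict_eq_zero, Measure.map_apply hτ hB, hnull]
    have := congrArg (fun k => Measure.restrict k B) heq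
    simpa [Measure.restrict_add, h0] using this
  simp only [mp, restrict_withDensity hB] at hres
  rw [withDensity_eq_iff_of_sigmaFinite
    (hq.const_mul 1).aemeasurable.ennreal_ofReal.restrict
    (hq.const_mul (-1)).aemeasurable.ennreal_ofReal.restrict] at hres
  rw [← ae_restrict_iff' hB]
  filter_upwards [hres] with x hx
  rcases lt_trichotomy (q x) 0 with h | h | h
  · rw [ENNReal.ofReal_of_nonpos (by linarith), eq_comm, ENNReal.ofReal_eq_zero] at hx
    linarith
  · exact h
  · rw [ENNReal.ofReal_of_nonpos (p := -1 * q x) (by linarith), ENNReal.ofReal_eq_zero] at hx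
    linarith

end TestFunctions

end CohesiveDynamics
end
noncomputable section
namespace CohesiveDynamics
variable {d : ℕ}

/-! ### Difference quotients of functions with a directional derivative measure -/

/-- The parameter interval of a segment. -/
def unitMeasure : Measure ℝ := volume.restrict (Icc 0 1)

instance : IsProbabilityMeasure unitMeasure :=
  ⟨by simp [unitMeasure]⟩

theorem integral_unitMeasure (h : ℝ → ℝ) : ∫ t, h t ∂unitMeasure = ∫ t in (0 : ℝ)..1, h t := by
  rw [unitMeasure, integral_Icc_eq_integral_Ioc, intervalIntegral.integral_of_le zero_le_one]

theorem integral_fderiv_segment {g : Space d → ℝ}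
    (hg : ContDiff ℝ ((⊤ : ℕ∞) : WithTop ℕ∞) g) (x z : Space d) :
    ∫ t, fderiv ℝ g (x - t • z) z ∂unitMeasure = g x - g (x - z) := by
  have hd : ∀ t : ℝ, HasDerivAt (fun t : ℝ => -g (x - t • z)) (fderiv ℝ g (x - t • z) z) t := by
    intro t
    have h1 : HasDerivAt (fun t : ℝ => x - t • z) (-z) t := by
      simpa using ((hasDerivAt_id t).smul_const z).const_sub x
    have h2 := ((hg.differentiable (by simp)) (x - t • z)).hasFDerivAt.comp_hasDerivAt t h1
    exact h2.neg.congr_deriv (by simp)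
  have hc : Continuous fun t : ℝ => fderiv ℝ g (x - t • z) z :=
    ((hg.continuous_fderiv (by simp)).comp (by fun_prop)).clm_apply continuous_const
  rw [integral_unitMeasure, intervalIntegral.integral_eq_sub_of_hasDerivAt (fun t _ => hd t)
    (hc.intervalIntegrable _ _)]
  simp only [one_smul, zero_smul, sub_zero]
  ring

theorem integrable_prod_mul_of_bounded {m : Measure (Space d)} [SFinite m] {w : Space d → ℝ}
    (hw : Integrable w m) {g : Space d → ℝ} (hg : Continuous g) {C : ℝ} (hC : ∀ x, ‖g x‖ ≤ C)
    (z : Space d) :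
    Integrable (fun p : ℝ × Space d => g (p.2 - p.1 • z) * w p.2) (unitMeasure.prod m) :=
  (hw.comp_snd unitMeasure).bdd_mul
    (by
      have : Continuous fun p : ℝ × Space d => g (p.2 - p.1 • z) := by fun_prop
      exact this.aestronglyMeasurable)
    (Eventually.of_forall fun p => hC _)

theorem integrable_prod_translate {G : Space d → ℝ} (hG : Integrable G) (hGm : Measurable G)
    (z : Space d) :
    Integrable (fun p : ℝ × Space d => G (p.2 + p.1 • z)) (unitMeasure.prod volume) := by
  have hm : Measurable fun p : ℝ × Space d => G (p.2 + p.1 • z) := hGm.comp (by fun_prop)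
  rw [integrable_prod_iff hm.aestronglyMeasurable]
  refine ⟨Eventually.of_forall fun t => hG.comp_add_right (t • z), ?_⟩
  simp only
  have : ∀ t : ℝ, ∫ x : Space d, ‖G (x + t • z)‖ = ∫ x : Space d, ‖G x‖ := fun t =>
    integral_add_right_eq_self (fun x => ‖G x‖) (t • z)
  simp only [this]
  exact integrable_const _

theorem contDiff_translate {g : Space d → ℝ} (hg : ContDiff ℝ ((⊤ : ℕ∞) : WithTop ℕ∞) g)
    (y : Space d) : ContDiff ℝ ((⊤ : ℕ∞) : WithTop ℕ∞) fun x => g (x - y) :=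
  hg.comp (contDiff_id.sub contDiff_const)

theorem hasCompactSupport_translate {g : Space d → ℝ} (hg : HasCompactSupport g) (y : Space d) :
    HasCompactSupport fun x => g (x - y) :=
  hg.comp_homeomorph (Homeomorph.subRight y)

/-- The weak identity is tested with the translates `g(· - tz)` and averaged over `t ∈ [0, 1]`. The
derivative term integrates to `g(x) - g(x - z)`, which a change of variables moves onto `v`; the
singular part becomes `θ m` swept backwards along `z`. -/
theorem integral_difference_mul_test {v G θ : Space d → ℝ} {m : Measure (Space d)}
    [IsFiniteMeasure m] (hv : Integrable v) (hG : Integrable G) (hGm : Measurable G)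
    (hθ : Integrable θ m) {z : Space d}
    (hweak : ∀ g : Space d → ℝ, ContDiff ℝ ((⊤ : ℕ∞) : WithTop ℕ∞) g → HasCompactSupport g →
      -∫ x, v x * fderiv ℝ g x z = (∫ x, G x * g x) + ∫ x, θ x * g x ∂m)
    {g : Space d → ℝ} (hg : ContDiff ℝ ((⊤ : ℕ∞) : WithTop ℕ∞) g) (hgc : HasCompactSupport g) :
    ∫ x, g x * (v (x + z) - v x - ∫ t, G (x + t • z) ∂unitMeasure) =
      ∫ p, g (p.2 - p.1 • z) * θ p.2 ∂(unitMeasure.prod m) := by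
  obtain ⟨C, hC⟩ := hgc.exists_bound_of_continuous hg.continuous
  have hdc : Continuous fun x => fderiv ℝ g x z :=
    (hg.continuous_fderiv (by simp)).clm_apply continuous_const
  obtain ⟨C', hC'⟩ : ∃ C', ∀ x, ‖fderiv ℝ g x z‖ ≤ C' := by
    obtain ⟨K, hK⟩ := (hgc.fderiv (𝕜 := ℝ)).exists_bound_of_continuous
      (hg.continuous_fderiv (by simp))
    exact ⟨K * ‖z‖, fun x => (ContinuousLinearMap.le_opNorm _ _).trans
      (mul_le_mul_of_nonneg_right (hK x) (norm_nonneg _))⟩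
  have iv := integrable_prod_mul_of_bounded hv hdc hC' z
  have iθ := integrable_prod_mul_of_bounded hθ hg.continuous hC z
  have iG := integrable_prod_translate hG hGm z
  have iGg : Integrable (fun p : ℝ × Space d => g p.2 * G (p.2 + p.1 • z))
      (unitMeasure.prod volume) :=
    iG.bdd_mul (hg.continuous.comp continuous_snd).aestronglyMeasurable
      (Eventually.of_forall fun p => hC p.2)
  have weak_t : ∀ t : ℝ, ∫ x, g (x - t • z) * θ x ∂m =
      -(∫ x, fderiv ℝ g (x - t • z) z * v x) - ∫ x, g x * G (x + t • z) := fun t => by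
    have h1 := hweak _ (contDiff_translate hg (t • z)) (hasCompactSupport_translate hgc (t • z))
    simp only [fderiv_comp_sub] at h1
    have h2 : ∫ x, G x * g (x - t • z) = ∫ x, g x * G (x + t • z) := by
      rw [← integral_add_right_eq_self (fun x => G x * g (x - t • z)) (t • z)]
      simp only [add_sub_cancel_right, mul_comm]
    rw [h2] at h1
    simp only [mul_comm (g _) (θ _), mul_comm (fderiv ℝ g _ z)]
    linarith
  rw [integral_prod _ iθ]
  simp only [weak_t]
  have iv' : Integrable (fun t : ℝ => -∫ x, fderiv ℝ g (x - t • z) z * v x) unitMeasure :=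
    iv.integral_prod_left.neg
  have iGg' : Integrable (fun t : ℝ => ∫ x, g x * G (x + t • z)) unitMeasure :=
    iGg.integral_prod_left
  have s1 : ∫ t, (∫ x, fderiv ℝ g (x - t • z) z * v x) ∂unitMeasure =
      ∫ x, ∫ t, fderiv ℝ g (x - t • z) z * v x ∂unitMeasure := integral_integral_swap iv
  have s2 : ∫ t, (∫ x, g x * G (x + t • z)) ∂unitMeasure =
      ∫ x, ∫ t, g x * G (x + t • z) ∂unitMeasure := integral_integral_swap iGg
  rw [integral_sub iv' iGg', integral_neg, s1, s2]
  simp only [integral_mul_const, integral_const_mul, integral_fderiv_segment hg]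
  have bdd : ∀ {w : Space d → ℝ} (y : Space d), Integrable w →
      Integrable fun x => g (x - y) * w x := fun y hw =>
    hw.bdd_mul (hg.continuous.comp (by fun_prop)).aestronglyMeasurable
      (Eventually.of_forall fun x => hC _)
  have bdd0 : ∀ {w : Space d → ℝ}, Integrable w → Integrable fun x => g x * w x := fun hw => by
    simpa using bdd 0 hw
  have iT : Integrable fun x => ∫ t, G (x + t • z) ∂unitMeasure := iG.integral_prod_right
  simp only [mul_sub, sub_mul]
  have i3 : Integrable fun x => g x * v (x + z) - g x * v x :=
    (bdd0 (hv.comp_add_right z)).sub (bdd0 hv)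
  rw [integral_sub i3 (bdd0 iT), integral_sub (bdd0 (hv.comp_add_right z)) (bdd0 hv),
    integral_sub (bdd0 hv) (bdd z hv)]
  have h3 : ∫ x, g (x - z) * v x = ∫ x, g x * v (x + z) := by
    rw [← integral_add_right_eq_self (fun x => g (x - z) * v x) z]
    simp only [add_sub_cancel_right]
  rw [h3]
  ring

/-- If the derivative of `v` in direction `z` is `G dx + θ σ⌊A`, then away from the points that a
translation by at most `z` carries to `A`, the increments of `v` are the integrals of `G`. -/
theorem ae_difference_eq_integral {v G θ : Space d → ℝ} {σ : Measure (Space d)}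
    {A : Set (Space d)} (hA : σ A ≠ ⊤) (hv : Integrable v) (hG : Integrable G)
    (hGm : Measurable G) (hθ : IntegrableOn θ A σ) {z : Space d}
    (hweak : ∀ g : Space d → ℝ, ContDiff ℝ ((⊤ : ℕ∞) : WithTop ℕ∞) g → HasCompactSupport g →
      -∫ x, v x * fderiv ℝ g x z = (∫ x, G x * g x) + ∫ x in A, θ x * g x ∂σ) :
    ∀ᵐ x, x ∉ toMeasurable volume (tube A z) →
      v (x + z) - v x = ∫ t, G (x + t • z) ∂unitMeasure := by
  have : IsFiniteMeasure (σ.restrict A) := ⟨by simpa using hA.lt_top⟩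
  have hq : Integrable fun x => v (x + z) - v x - ∫ t, G (x + t • z) ∂unitMeasure :=
    ((hv.comp_add_right z).sub hv).sub (integrable_prod_translate hG hGm z).integral_prod_right
  have hτ : Measurable fun p : ℝ × Space d => p.2 - p.1 • z := by fun_prop
  have hB := (measurableSet_toMeasurable volume (tube A z)).compl
  -- The swept measure lives on the points `x - tz` with `x ∈ A`, all of which lie in the tube. The
  -- measurable hull of the tube is used because `A` is not assumed measurable.
  have hnull : (unitMeasure.prod (σ.restrict A))
      ((fun p : ℝ × Space d => p.2 - p.1 • z) ⁻¹' (toMeasurable volume (tube A z))ᶜ) = 0 := by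
    rw [Measure.measure_prod_null (hτ hB)]
    have : ∀ᵐ t ∂unitMeasure, t ∈ Icc (0 : ℝ) 1 := ae_restrict_mem measurableSet_Icc
    filter_upwards [this] with t ht
    rw [Pi.zero_apply, Measure.restrict_apply ((hτ hB).preimage (by fun_prop)), ← nonpos_iff_eq_zero]
    refine le_of_le_of_eq (measure_mono (t := ∅) ?_) measure_empty
    rintro x ⟨hx, hxA⟩
    exact hx (subset_toMeasurable _ _ ⟨t, ht, by simpa using hxA⟩)
  have := ae_eq_zero_of_integral_test_eq hq (hθ.comp_snd unitMeasure) hτ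
    (fun g hg hgc => integral_difference_mul_test hv hG hGm hθ hweak hg hgc) hB hnull
  filter_upwards [this] with x hx hx'
  exact sub_eq_zero.1 (hx hx')

end CohesiveDynamics
end
noncomputable section
namespace CohesiveDynamics
variable {d : ℕ}

/-! ### Geometry of the body -/

/-- A ball is connected: if it left `D` it would meet the boundary at distance less than `α` from
its centre. -/
theorem ball_subset_of_mem_interiorPart {D : Set (Space d)} {α : ℝ} {x : Space d}
    (hx : x ∈ interiorPart D α) : Metric.ball x α ⊆ D := by
  rcases le_or_gt α 0 with hα | hα
  · simp [Metric.ball_eq_empty.2 hα]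
  by_contra hsub
  have hne : (Metric.ball x α ∩ frontier D).Nonempty := by
    by_contra hempty
    have hcov : ∀ w ∈ Metric.ball x α, w ∈ interior D ∨ w ∈ (closure D)ᶜ := fun w hw => by
      by_contra! h
      exact hempty ⟨w, hw, not_not.1 h.2, h.1⟩
    obtain ⟨y, hy, hyD⟩ := not_subset.1 hsub
    obtain ⟨w, -, hw1, hw2⟩ := (convex_ball x α).isPreconnected (interior D) (closure D)ᶜ
      isOpen_interior isClosed_closure.isOpen_compl hcov
      ⟨x, Metric.mem_ball_self hα, (hcov x (Metric.mem_ball_self hα)).resolve_right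
        fun h => h (subset_closure hx.1)⟩
      ⟨y, hy, (hcov y hy).resolve_left fun h => hyD (interior_subset h)⟩
    exact hw2 (subset_closure (interior_subset hw1))
  obtain ⟨y, hy, hyf⟩ := hne
  refine hx.2 ⟨hx.1, (Metric.infDist_le_dist_of_mem hyf).trans_lt ?_⟩
  rwa [dist_comm]

/-- `D` is open, but limit points of `D_s` stay in `D` because of the uniform balls of radius `α`.
-/
theorem isClosed_interiorPart {D : Set (Space d)} {α : ℝ} (hα : 0 < α) :
    IsClosed (interiorPart D α) := by
  refine isClosed_of_closure_subset fun x hx => ?_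
  obtain ⟨y, hy, hxy⟩ := Metric.mem_closure_iff.1 hx α hα
  have hxD : x ∈ D := ball_subset_of_mem_interiorPart hy hxy
  refine ⟨hxD, fun hxc => ?_⟩
  have hopen : IsOpen {w : Space d | Metric.infDist w (frontier D) < α} :=
    isOpen_lt (Metric.continuous_infDist_pt _) continuous_const
  obtain ⟨w, hw, hwS⟩ := mem_closure_iff.1 hx _ hopen hxc.2
  exact hwS.2 ⟨hwS.1, hw⟩

theorem isCompact_interiorPart {D : Set (Space d)} (hb : Bornology.IsBounded D)
    {α : ℝ} (hα : 0 < α) : IsCompact (interiorPart D α) :=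
  Metric.isCompact_of_isClosed_isBounded (isClosed_interiorPart hα) (hb.subset fun _ h => h.1)

/-- Multiplication by `χ` turns a test function on the whole space into one supported in `D`.
Equality to `1` on a neighbourhood of `K`, not just on `K`, leaves derivatives on `K` unchanged. -/
theorem exists_cutoff {D K : Set (Space d)} (hD : IsOpen D) (hK : IsCompact K) (hKD : K ⊆ D) :
    ∃ χ : Space d → ℝ, ContDiff ℝ ((⊤ : ℕ∞) : WithTop ℕ∞) χ ∧ HasCompactSupport χ ∧
      tsupport χ ⊆ D ∧ (∀ᶠ x in 𝓝ˢ K, χ x = 1) ∧ ∀ x, χ x ∈ Icc (0 : ℝ) 1 := by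
  obtain ⟨L, hL, hKL, hLD⟩ := exists_compact_between hK hD hKD
  obtain ⟨χ, h1, h0, hχ⟩ := exists_contMDiffMap_one_nhds_of_subset_interior
    (modelWithCornersSelf ℝ (Space d)) (n := (⊤ : ℕ∞)) hK.isClosed hKL
  have hsub : tsupport χ ⊆ L := closure_minimal
    (fun x hx => by by_contra h; exact hx (h0 x h)) hL.isClosed
  exact ⟨χ, χ.contMDiff.contDiff, hL.of_isClosed_subset (isClosed_tsupport _) hsub,
    hsub.trans hLD, h1, hχ⟩

/-! ### Displacement fields -/

variable {D : Set (Space d)} {α : ℝ}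

theorem measurable_field (w : L20 D α) : Measurable (field w) :=
  (Lp.stronglyMeasurable (w : Lp (Space d) 2 (volume : Measure (Space d)))).measurable

theorem field_ae_eq_zero (w : L20 D α) : ∀ᵐ x, x ∉ interiorPart D α → field w x = 0 := w.2

theorem memLp_field (w : L20 D α) : MemLp (field w) 2 (volume : Measure (Space d)) :=
  Lp.memLp (w : Lp (Space d) 2 (volume : Measure (Space d)))

theorem integrable_field (hb : Bornology.IsBounded D) (w : L20 D α) :
    Integrable (field w) (volume : Measure (Space d)) := by
  have hfin : IsFiniteMeasure ((volume : Measure (Space d)).restrict (closure D)) :=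
    ⟨by simpa using hb.closure.measure_lt_top⟩
  have h1 : IntegrableOn (field w) (closure D) :=
    ((memLp_field w).restrict (closure D)).integrable (by norm_num)
  refine h1.integrable_of_ae_notMem_eq_zero ?_
  filter_upwards [field_ae_eq_zero w] with x hx hxD
  exact hx fun h => hxD (subset_closure h.1)

/-! ### The weak formulation of the symmetric gradient -/

theorem fderiv_eq_sum_partialDeriv (φ : Space d → ℝ) (x z : Space d) :
    fderiv ℝ φ x z = ∑ j, z j * partialDeriv φ j x := by
  have hz : z = ∑ j, z j • (EuclideanSpace.single j (1 : ℝ) : Space d) := by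
    have := (EuclideanSpace.basisFun (Fin d) ℝ).sum_repr z
    simpa using this.symm
  conv_lhs => rw [hz]
  simp [partialDeriv]

theorem inner_eq_sum (a z : Space d) : inner ℝ a z = ∑ i, z i * a i := by
  simp [PiLp.inner_apply]

/-- Quadratic form of a field of matrices. -/
def quadForm (a : Fin d → Fin d → Space d → ℝ) (z x : Space d) : ℝ :=
  ∑ i, ∑ j, z i * z j * a i j x

theorem quadForm_sq_le (a : Fin d → Fin d → Space d → ℝ) (z x : Space d) :
    quadForm a z x ^ 2 ≤ ‖z‖ ^ 4 * ∑ i, ∑ j, a i j x ^ 2 := by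
  have h1 := Finset.sum_mul_sq_le_sq_mul_sq Finset.univ (fun p : Fin d × Fin d => z p.1 * z p.2)
    (fun p => a p.1 p.2 x)
  simp only [Fintype.sum_prod_type] at h1
  refine h1.trans_eq ?_
  congr 1
  have h2 : ‖z‖ ^ 2 = ∑ i, z i ^ 2 := by simp [EuclideanSpace.norm_sq_eq]
  rw [show ‖z‖ ^ 4 = ‖z‖ ^ 2 * ‖z‖ ^ 2 by ring, h2, Finset.sum_mul_sum]
  simp only [mul_pow]

theorem integral_quadForm_mul {a : Fin d → Fin d → Space d → ℝ} {m : Measure (Space d)}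
    {φ : Space d → ℝ} (ha : ∀ i j, Integrable (fun x => a i j x * φ x) m) (z : Space d) :
    ∫ x, quadForm a z x * φ x ∂m = ∑ i, ∑ j, z i * z j * ∫ x, a i j x * φ x ∂m := by
  simp only [quadForm, Finset.sum_mul, mul_assoc]
  rw [integral_finsetSum _ fun i _ => integrable_finsetSum _ fun j _ =>
    ((ha i j).const_mul _).const_mul _]
  refine Finset.sum_congr rfl fun i _ => ?_
  rw [integral_finsetSum _ fun j _ => ((ha i j).const_mul _).const_mul _]
  simp only [integral_const_mul]

theorem integrable_quadForm {a : Fin d → Fin d → Space d → ℝ} {m : Measure (Space d)}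
    (ha : ∀ i j, Integrable (a i j) m) (z : Space d) : Integrable (quadForm a z) m :=
  integrable_finsetSum _ fun i _ => integrable_finsetSum _ fun j _ => (ha i j).const_mul _

/-- Contraction with `z ⊗ z` does not see the antisymmetric part. This is why the symmetric gradient
alone controls the longitudinal increments, the only ones the strain involves. -/
theorem quadForm_symm_grad (u : Space d → Space d) (φ : Space d → ℝ) (z x : Space d) :
    quadForm (fun i j x => (u x i * partialDeriv φ j x + u x j * partialDeriv φ i x) / 2) z x =
      inner ℝ (u x) z * fderiv ℝ φ x z := by
  rw [fderiv_eq_sum_partialDeriv, inner_eq_sum]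
  have h1 : quadForm (fun i j x => (u x i * partialDeriv φ j x + u x j * partialDeriv φ i x) / 2)
      z x = (∑ i, ∑ j, z i * u x i * (z j * partialDeriv φ j x)) / 2 +
        (∑ i, ∑ j, z j * u x j * (z i * partialDeriv φ i x)) / 2 := by
    simp only [quadForm, Finset.sum_div, ← Finset.sum_add_distrib]
    refine Finset.sum_congr rfl fun i _ => Finset.sum_congr rfl fun j _ => ?_
    ring
  rw [h1, Finset.sum_comm (f := fun i j => z j * u x j * (z i * partialDeriv φ i x)),
    Finset.sum_mul_sum, add_halves]

theorem continuous_partialDeriv {φ : Space d → ℝ} (hφ : ContDiff ℝ ((⊤ : ℕ∞) : WithTop ℕ∞) φ)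
    (j : Fin d) : Continuous (partialDeriv φ j) :=
  (hφ.continuous_fderiv (by simp)).clm_apply continuous_const

theorem exists_bound_partialDeriv {φ : Space d → ℝ}
    (hφ : ContDiff ℝ ((⊤ : ℕ∞) : WithTop ℕ∞) φ) (hφc : HasCompactSupport φ) (j : Fin d) :
    ∃ C, ∀ x, ‖partialDeriv φ j x‖ ≤ C := by
  refine HasCompactSupport.exists_bound_of_continuous ?_ (continuous_partialDeriv hφ j)
  exact (hφc.fderiv (𝕜 := ℝ)).mono fun x hx h => hx (by simp [partialDeriv, h])

theorem integrable_coord {m : Measure (Space d)} {u : Space d → Space d} (hu : Integrable u m)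
    (i : Fin d) : Integrable (fun x => u x i) m :=
  (EuclideanSpace.proj (𝕜 := ℝ) i).integrable_comp hu

theorem weak_quadForm {u : Space d → Space d} {e : Space d → Matrix (Fin d) (Fin d) ℝ}
    {jt : Fin d → Fin d → Space d → ℝ} {A : Set (Space d)} {σ : Measure (Space d)}
    (hu : IntegrableOn u D) (he : ∀ i j, IntegrableOn (fun x => e x i j) D)
    (hjt : ∀ i j, IntegrableOn (jt i j) A σ)
    {φ : Space d → ℝ} (hφ : ContDiff ℝ ((⊤ : ℕ∞) : WithTop ℕ∞) φ) (hφc : HasCompactSupport φ)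
    (h : ∀ i j : Fin d, -∫ x in D, (u x i * partialDeriv φ j x + u x j * partialDeriv φ i x) / 2 =
        (∫ x in D, e x i j * φ x) + ∫ x in A, jt i j x * φ x ∂σ) (z : Space d) :
    -∫ x in D, inner ℝ (u x) z * fderiv ℝ φ x z =
      (∫ x in D, quadForm (fun i j x => e x i j) z x * φ x) +
        ∫ x in A, quadForm jt z x * φ x ∂σ := by
  obtain ⟨C, hC⟩ := hφc.exists_bound_of_continuous hφ.continuous
  have b1 : ∀ {m : Measure (Space d)} {w : Space d → ℝ}, Integrable w m →
      Integrable (fun x => w x * φ x) m := fun hw =>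
    hw.mul_bdd hφ.continuous.aestronglyMeasurable (Eventually.of_forall hC)
  have b2 : ∀ i j, IntegrableOn (fun x => u x i * partialDeriv φ j x) D := fun i j => by
    obtain ⟨K, hK⟩ := exists_bound_partialDeriv hφ hφc j
    exact (integrable_coord hu i).mul_bdd (continuous_partialDeriv hφ j).aestronglyMeasurable
      (Eventually.of_forall hK)
  have b3 : ∀ i j, Integrable (fun x =>
      (u x i * partialDeriv φ j x + u x j * partialDeriv φ i x) / 2 * (fun _ => (1 : ℝ)) x)
      (volume.restrict D) := fun i j => by
    simpa using ((b2 i j).add (b2 j i)).div_const 2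
  rw [integral_quadForm_mul (fun i j => b1 (he i j)), integral_quadForm_mul fun i j => b1 (hjt i j)]
  have h1 := integral_quadForm_mul b3 z
  simp only [mul_one, quadForm_symm_grad] at h1
  rw [h1, ← Finset.sum_neg_distrib, ← Finset.sum_add_distrib]
  refine Finset.sum_congr rfl fun i _ => ?_
  rw [← Finset.sum_neg_distrib, ← Finset.sum_add_distrib]
  refine Finset.sum_congr rfl fun j _ => ?_
  rw [← mul_add, ← h i j]
  ring

end CohesiveDynamics
end
-- Increments of displacements with finite fracture energy
noncomputable section
namespace CohesiveDynamics
variable {d : ℕ} {D : Set (Space d)} {α : ℝ}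

theorem ofReal_sq_integral_le {X : Type*} [MeasurableSpace X] {m : Measure X}
    [IsProbabilityMeasure m] (h : X → ℝ) :
    ENNReal.ofReal ((∫ x, h x ∂m) ^ 2) ≤ ∫⁻ x, ENNReal.ofReal (h x ^ 2) ∂m := by
  by_cases hm : AEStronglyMeasurable h m
  · have sq : ∀ r : ℝ, ENNReal.ofReal (r ^ 2) = ‖r‖ₑ ^ 2 := fun r => by
      rw [← sq_abs, ENNReal.ofReal_pow (abs_nonneg _), ← Real.norm_eq_abs, ofReal_norm]
    have h1 : ‖∫ x, h x ∂m‖ₑ ≤ eLpNorm h 2 m :=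
      ((enorm_integral_le_lintegral_enorm h).trans_eq eLpNorm_one_eq_lintegral_enorm.symm).trans
        (eLpNorm_le_eLpNorm_of_exponent_le (by norm_num) hm)
    simp only [sq]
    refine (pow_le_pow_left₀ zero_le h1 2).trans_eq ?_
    rw [eLpNorm_eq_lintegral_rpow_enorm_toReal (by norm_num) (by norm_num)]
    simp only [ENNReal.toReal_ofNat, ENNReal.rpow_ofNat]
    rw [← ENNReal.rpow_natCast, ← ENNReal.rpow_mul]
    norm_num
  -- The integral of a non-measurable function is `0` by convention.
  · simp [integral_non_aestronglyMeasurable hm]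

/-- The weak formulation of the symmetric gradient on the whole space, for a displacement which
vanishes off `interiorPart D α` and a cutoff function. -/
theorem weak_directional (hDm : MeasurableSet D) {w : L20 D α} {χ : Space d → ℝ}
    (hχ : ContDiff ℝ ((⊤ : ℕ∞) : WithTop ℕ∞) χ) (hχc : HasCompactSupport χ)
    (hχD : tsupport χ ⊆ D) (hχ1 : ∀ᶠ x in 𝓝ˢ (interiorPart D α), χ x = 1)
    {e : Space d → Matrix (Fin d) (Fin d) ℝ} {a jt : Fin d → Fin d → Space d → ℝ}
    {A : Set (Space d)} {σ : Measure (Space d)}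
    (hu : IntegrableOn (field w) D) (he : ∀ i j, IntegrableOn (fun x => e x i j) D)
    (ha : ∀ i j, a i j =ᵐ[volume] D.indicator fun x => e x i j)
    (hjt : ∀ i j, IntegrableOn (jt i j) A σ)
    (h : ∀ φ : Space d → ℝ, ContDiff ℝ ((⊤ : ℕ∞) : WithTop ℕ∞) φ → HasCompactSupport φ →
      tsupport φ ⊆ D → ∀ i j : Fin d,
      -∫ x in D, (field w x i * partialDeriv φ j x + field w x j * partialDeriv φ i x) / 2 =
        (∫ x in D, e x i j * φ x) + ∫ x in A, jt i j x * φ x ∂σ)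
    (z : Space d) {g : Space d → ℝ} (hg : ContDiff ℝ ((⊤ : ℕ∞) : WithTop ℕ∞) g) :
    -∫ x, inner ℝ (field w x) z * fderiv ℝ g x z =
      (∫ x, χ x * quadForm a z x * g x) + ∫ x in A, quadForm jt z x * χ x * g x ∂σ := by
  have hφ : ContDiff ℝ ((⊤ : ℕ∞) : WithTop ℕ∞) fun x => χ x * g x := hχ.mul hg
  have hφc : HasCompactSupport fun x => χ x * g x := hχc.mul_right
  have hφD : tsupport (fun x => χ x * g x) ⊆ D := (tsupport_mul_subset_left).trans hχD
  have key := weak_quadForm hu he hjt hφ hφc (h _ hφ hφc hφD) z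
  -- On `D_s` the cutoff is locally `1`, and elsewhere the displacement vanishes, so the cutoff
  -- disappears from this term.
  have e1 : ∫ x in D, inner ℝ (field w x) z * fderiv ℝ (fun x => χ x * g x) x z =
      ∫ x, inner ℝ (field w x) z * fderiv ℝ g x z := by
    rw [← integral_indicator hDm]
    refine integral_congr_ae ?_
    filter_upwards [field_ae_eq_zero w] with x hx
    by_cases hxS : x ∈ interiorPart D α
    · rw [indicator_of_mem hxS.1]
      have : (fun x => χ x * g x) =ᶠ[𝓝 x] g := by
        filter_upwards [eventually_nhdsSet_iff_forall.1 hχ1 x hxS] with y hy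
        rw [hy, one_mul]
      rw [this.fderiv_eq]
    · simp [indicator, hx hxS]
  have e2 : ∫ x in D, quadForm (fun i j x => e x i j) z x * (χ x * g x) =
      ∫ x, χ x * quadForm a z x * g x := by
    rw [← integral_indicator hDm]
    refine integral_congr_ae ?_
    filter_upwards [ae_all_iff.2 fun i => ae_all_iff.2 fun j => ha i j] with x hx
    by_cases hxD : x ∈ D
    · rw [indicator_of_mem hxD]
      simp only [quadForm, hx, indicator_of_mem hxD]
      ring
    · have : χ x = 0 := image_eq_zero_of_notMem_tsupport fun h => hxD (hχD h)
      simp [indicator, hxD, this]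
  rw [e1, e2] at key
  rw [key]
  simp only [mul_assoc]

theorem lintegral_strain_ne_top {mu lam Gc : ℝ} (hmu : 0 < mu) (hlam : 0 < lam)
    {u : Space d → Space d} {e : Space d → Matrix (Fin d) (Fin d) ℝ}
    (h : LEFM mu lam Gc D u e < ⊤) :
    ∫⁻ x in D, ENNReal.ofReal (∑ i, ∑ j, (e x i j) ^ 2) ≠ ⊤ := by
  have h1 := (ENNReal.add_lt_top.1 h).1
  have h2 : ENNReal.ofReal (2 * mu) * ∫⁻ x in D, ENNReal.ofReal (∑ i, ∑ j, (e x i j) ^ 2) < ⊤ := by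
    rw [← lintegral_const_mul' _ _ ENNReal.ofReal_ne_top]
    refine lt_of_le_of_lt (lintegral_mono fun x => ?_) h1
    rw [← ENNReal.ofReal_mul (by positivity)]
    exact ENNReal.ofReal_le_ofReal (le_add_of_nonneg_right (by positivity))
  exact (ENNReal.lt_top_of_mul_ne_top_right h2.ne (by simpa using hmu)).ne

theorem surfaceMeasure_jumpSet_ne_top {mu lam Gc : ℝ} (hGc : 0 < Gc)
    {u : Space d → Space d} {e : Space d → Matrix (Fin d) (Fin d) ℝ}
    (h : LEFM mu lam Gc D u e < ⊤) : surfaceMeasure d (jumpSet D u) ≠ ⊤ :=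
  (ENNReal.lt_top_of_mul_ne_top_right (ENNReal.add_lt_top.1 h).2.ne (by simpa using hGc)).ne

/-- Off the tubes around the jump set, the increments of a displacement of finite fracture energy
are controlled by the square integral of the strain along segments. -/
theorem exists_increment_bound (hD : IsOpen D) (hb : Bornology.IsBounded D) (hα : 0 < α)
    {mu lam Gc : ℝ} (hmu : 0 < mu) (hlam : 0 < lam) (hGc : 0 < Gc) {w : L20 D α}
    (hw : HasFiniteLEFM mu lam Gc D (field w)) :
    ∃ (g : Space d → ENNReal) (A : Set (Space d)), Measurable g ∧ ∫⁻ x, g x ≠ ⊤ ∧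
      surfaceMeasure d A ≠ ⊤ ∧ ∀ z, ∀ᵐ x, x ∉ toMeasurable volume (tube A z) →
        ENNReal.ofReal (inner ℝ (field w (x + z) - field w x) z ^ 2) ≤
          ENNReal.ofReal (‖z‖ ^ 4) * ∫⁻ t, g (x + t • z) ∂unitMeasure := by
  obtain ⟨e, ⟨hu, he, uP, uM, ν, -, hjt, hweak⟩, hL⟩ := hw
  obtain ⟨χ, hχ, hχc, hχD, hχ1, hχI⟩ := exists_cutoff hD (isCompact_interiorPart hb hα)
    (fun x hx => hx.1)
  have hind : ∀ i j, Integrable (D.indicator fun x => e x i j) := fun i j =>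
    (integrable_indicator_iff hD.measurableSet).2 (he i j)
  -- Measurable representatives of the strain extended by zero: they are evaluated along whole
  -- segments.
  set a : Fin d → Fin d → Space d → ℝ := fun i j => (hind i j).1.mk _ with ha_def
  have ham : ∀ i j, Measurable (a i j) := fun i j => (hind i j).1.stronglyMeasurable_mk.measurable
  have hae : ∀ i j, a i j =ᵐ[volume] D.indicator fun x => e x i j := fun i j =>
    (hind i j).1.ae_eq_mk.symm
  have hai : ∀ i j, Integrable (a i j) := fun i j => (hind i j).congr (hae i j).symm
  refine ⟨fun x => ENNReal.ofReal (∑ i, ∑ j, a i j x ^ 2), jumpSet D (field w), ?_, ?_,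
    surfaceMeasure_jumpSet_ne_top hGc hL, fun z => ?_⟩
  · exact ENNReal.measurable_ofReal.comp (Finset.measurable_sum _ fun i _ =>
      Finset.measurable_sum _ fun j _ => (ham i j).pow_const 2)
  · have : ∫⁻ x, ENNReal.ofReal (∑ i, ∑ j, a i j x ^ 2) =
        ∫⁻ x in D, ENNReal.ofReal (∑ i, ∑ j, (e x i j) ^ 2) := by
      rw [← lintegral_indicator hD.measurableSet]
      refine lintegral_congr_ae ?_
      filter_upwards [ae_all_iff.2 fun i => ae_all_iff.2 fun j => hae i j] with x hx
      by_cases hxD : x ∈ D <;> simp [hx, hxD]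
    rw [this]
    exact lintegral_strain_ne_top hmu hlam hL
  · obtain ⟨C, hC⟩ := hχc.exists_bound_of_continuous hχ.continuous
    have hqm : Measurable (quadForm a z) := Finset.measurable_sum _ fun i _ =>
      Finset.measurable_sum _ fun j _ => (ham i j).const_mul _
    have hdiff := ae_difference_eq_integral (v := fun x => inner ℝ (field w x) z)
      (G := fun x => χ x * quadForm a z x) (θ := fun x => quadForm (jumpTensor uP uM ν) z x * χ x)
      (σ := surfaceMeasure d) (A := jumpSet D (field w)) (z := z)
      (surfaceMeasure_jumpSet_ne_top hGc hL) ((integrable_field hb w).inner_const z)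
      ((integrable_quadForm hai z).bdd_mul hχ.continuous.aestronglyMeasurable
        (Eventually.of_forall hC))
      (hχ.continuous.measurable.mul hqm)
      ((integrable_quadForm hjt z).mul_bdd hχ.continuous.aestronglyMeasurable
        (Eventually.of_forall hC))
      (fun g hg _ => weak_directional hD.measurableSet hχ hχc hχD hχ1 hu he hae hjt hweak z hg)
    filter_upwards [hdiff] with x hx hxt
    rw [inner_sub_left, hx hxt]
    -- Jensen along the segment, then Cauchy–Schwarz for the quadratic form and `χ² ≤ 1`.
    refine (ofReal_sq_integral_le _).trans ?_
    rw [← lintegral_const_mul' _ _ ENNReal.ofReal_ne_top]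
    refine lintegral_mono fun t => ?_
    rw [← ENNReal.ofReal_mul (by positivity)]
    refine ENNReal.ofReal_le_ofReal ?_
    have h1 := quadForm_sq_le a z (x + t • z)
    have h2 : χ (x + t • z) ^ 2 ≤ 1 := pow_le_one₀ (hχI _).1 (hχI _).2
    rw [mul_pow]
    exact (mul_le_of_le_one_left (sq_nonneg _) h2).trans h1

end CohesiveDynamics
end
noncomputable section
namespace CohesiveDynamics
variable {d : ℕ} {D : Set (Space d)} {α : ℝ} {f : ℝ → ℝ} {J : ℝ → ℝ → ℝ} {M : ℝ}

/-! ### Measurability -/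

theorem measurable_bond : Measurable fun p : Space d × Space d => bond p.1 p.2 := by
  unfold bond
  fun_prop

theorem measurable_strain {u : Space d → Space d} (hu : Measurable u) :
    Measurable fun p : Space d × Space d => strain u p.1 p.2 := by
  have h1 := measurable_bond (d := d)
  have h2 : Measurable fun p : Space d × Space d => ‖p.2 - p.1‖⁻¹ • (u p.2 - u p.1) := by
    fun_prop
  exact h2.inner h1

theorem measurable_influence (hJ : IsInfluence J M) {ε : ℝ} (hε : 0 < ε) :
    Measurable fun p : Space d × Space d => J ε ‖p.2 - p.1‖ :=
  (hJ.measurable ε hε).comp (by fun_prop)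

theorem measurable_comp_of_continuousOn_Ici {X : Type*} [MeasurableSpace X] {h : ℝ → ℝ}
    (hh : ContinuousOn h (Ici 0)) {r : X → ℝ} (hr : Measurable r) (hr0 : ∀ x, 0 ≤ r x) :
    Measurable fun x => h (r x) := by
  have hc : Continuous fun s : ℝ => h (max s 0) :=
    hh.comp_continuous (by fun_prop) fun s => le_max_right s 0
  have := hc.measurable.comp hr
  simpa only [Function.comp_def, max_eq_left (hr0 _)] using this

theorem measurable_potential (hf : IsCohesivePotential f) (hJ : IsInfluence J M) {ε : ℝ}
    (hε : 0 < ε) {u : Space d → Space d} (hu : Measurable u) :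
    Measurable fun p : Space d × Space d =>
      potential f J ε (strain u p.1 p.2) (p.2 - p.1) := by
  simp only [potential_eq hf]
  refine ((measurable_influence hJ hε).const_mul _).mul ?_
  refine measurable_comp_of_continuousOn_Ici hf.continuousOn ?_ fun p => by positivity
  exact (by fun_prop : Measurable fun p : Space d × Space d => ‖p.2 - p.1‖).mul
    ((measurable_strain hu).pow_const 2)

theorem measurable_forcePerLength (hf : IsCohesivePotential f) (hJ : IsInfluence J M) {ε : ℝ}
    (hε : 0 < ε) {u : Space d → Space d} (hu : Measurable u) :
    Measurable fun p : Space d × Space d =>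
      forcePerLength f J ε (strain u p.1 p.2) (p.2 - p.1) := by
  simp only [forcePerLength_eq hf]
  have hn : Measurable fun p : Space d × Space d => ‖p.2 - p.1‖ := by fun_prop
  have hs := measurable_strain hu
  refine ((measurable_influence hJ hε).const_mul _).mul (Measurable.mul (Measurable.const_mul ?_ _)
    ((hn.inv.mul hn).mul hs))
  exact measurable_comp_of_continuousOn_Ici hf.continuousOn_derivWithin
    (hn.mul (hs.pow_const 2)) fun p => by positivity

/-! ### The energy of the initial displacement -/

theorem norm_mul_strain_sq (u : Space d → Space d) (x : Space d) {z : Space d} (hz : z ≠ 0) :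
    ‖z‖ * strain u x (x + z) ^ 2 = (‖z‖ ^ 3)⁻¹ * inner ℝ (u (x + z) - u x) z ^ 2 := by
  have := norm_ne_zero_iff.2 hz
  simp only [strain, bond, add_sub_cancel_left, real_inner_smul_left, real_inner_smul_right]
  field_simp

theorem lintegral_lintegral_segment {g : Space d → ENNReal} (hg : Measurable g) (z : Space d) :
    ∫⁻ x, ∫⁻ t, g (x + t • z) ∂unitMeasure = ∫⁻ x, g x := by
  rw [lintegral_lintegral_swap]
  · have : ∀ t : ℝ, ∫⁻ x, g (x + t • z) = ∫⁻ x, g x := fun t =>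
      lintegral_add_right_eq_self g (t • z)
    simp [this]
  · exact (hg.comp (by fun_prop : Measurable fun p : Space d × ℝ => p.1 + p.2 • z)).aemeasurable

/-- On the tube `f ≤ B` is integrated over a set of volume at most `V‖z‖`. Off it, `f(r) ≤ K r` with
`K = f'(0)`, and the increment bound gives `K‖z‖⁴/‖z‖³ = K‖z‖` times the segment average of `g`,
whose integral over `x` is that of `g`. The common factor `‖z‖ < ε` cancels `1/ε`. -/
theorem lintegral_potential_le (hf : IsCohesivePotential f) (hJ : IsInfluence J M) {ε : ℝ}
    (hε : 0 < ε) {B : ℝ} (hB : ∀ r, 0 ≤ r → f r ≤ B) {u : Space d → Space d}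
    {g : Space d → ENNReal} (hg : Measurable g) {A : Set (Space d)} {V : ENNReal} {z : Space d}
    (hV : volume (tube A z) ≤ V * ENNReal.ofReal ‖z‖) (hz : z ≠ 0) (hzε : ‖z‖ < ε)
    (hu : ∀ᵐ x, x ∉ toMeasurable volume (tube A z) →
        ENNReal.ofReal (inner ℝ (u (x + z) - u x) z ^ 2) ≤
          ENNReal.ofReal (‖z‖ ^ 4) * ∫⁻ t, g (x + t • z) ∂unitMeasure) :
    ∫⁻ x, ENNReal.ofReal (potential f J ε (strain u x (x + z)) z) ≤
      ENNReal.ofReal M * (ENNReal.ofReal B * V +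
        ENNReal.ofReal (derivWithin f (Ici 0) 0) * ∫⁻ x, g x) := by
  set K := derivWithin f (Ici 0) 0 with hK
  have hK0 : 0 ≤ K := hf.slope_pos.le
  set W := toMeasurable volume (tube A z)
  have hWm : MeasurableSet W := measurableSet_toMeasurable _ _
  have hzn := norm_pos_iff.2 hz
  have hM := hJ.bound_pos
  have hpt : ∀ᵐ x, ENNReal.ofReal (potential f J ε (strain u x (x + z)) z) ≤
      ENNReal.ofReal (1 / ε * M) * (W.indicator (fun _ => ENNReal.ofReal B) x +
        ENNReal.ofReal (K * ‖z‖) * ∫⁻ t, g (x + t • z) ∂unitMeasure) := by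
    filter_upwards [hu] with x hx
    set r := ‖z‖ * strain u x (x + z) ^ 2 with hr
    have hr0 : 0 ≤ r := by positivity
    have h1 : potential f J ε (strain u x (x + z)) z ≤ 1 / ε * M * f r := by
      rw [potential_eq hf]
      have := hf.nonneg hr0
      have := hJ.le_bound hε (norm_nonneg z)
      gcongr
    refine (ENNReal.ofReal_le_ofReal h1).trans ?_
    rw [ENNReal.ofReal_mul (by positivity)]
    gcongr
    by_cases hxW : x ∈ W
    · rw [indicator_of_mem hxW]
      exact (ENNReal.ofReal_le_ofReal (hB r hr0)).trans le_self_add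
    · rw [indicator_of_notMem hxW, zero_add]
      refine (ENNReal.ofReal_le_ofReal (hf.le_linear hr0)).trans ?_
      rw [hr, norm_mul_strain_sq u x hz, ← mul_assoc, ENNReal.ofReal_mul (by positivity)]
      refine (mul_le_mul_right (hx hxW) _).trans_eq ?_
      rw [← mul_assoc, ← ENNReal.ofReal_mul (by positivity)]
      congr 2
      rw [← hK]
      field_simp
  have hgm : Measurable fun x => ∫⁻ t, g (x + t • z) ∂unitMeasure :=
    Measurable.lintegral_prod_right'
      (hg.comp (by fun_prop : Measurable fun p : Space d × ℝ => p.1 + p.2 • z))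
  refine (lintegral_mono_ae hpt).trans ?_
  rw [lintegral_const_mul' _ _ ENNReal.ofReal_ne_top, lintegral_add_right _ (hgm.const_mul _),
    lintegral_const_mul _ hgm, lintegral_lintegral_segment hg, lintegral_indicator_const hWm,
    measure_toMeasurable]
  calc ENNReal.ofReal (1 / ε * M) * (ENNReal.ofReal B * volume (tube A z) +
        ENNReal.ofReal (K * ‖z‖) * ∫⁻ x, g x)
      ≤ ENNReal.ofReal (1 / ε * M) * (ENNReal.ofReal B * (V * ENNReal.ofReal ‖z‖) +
        ENNReal.ofReal K * ENNReal.ofReal ‖z‖ * ∫⁻ x, g x) := by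
        rw [ENNReal.ofReal_mul hK0]
        gcongr
    _ = ENNReal.ofReal (1 / ε * M * ‖z‖) * (ENNReal.ofReal B * V +
        ENNReal.ofReal K * ∫⁻ x, g x) := by
        rw [ENNReal.ofReal_mul (p := 1 / ε * M) (by positivity)]
        ring
    _ ≤ _ := by
        gcongr
        rw [mul_right_comm]
        refine mul_le_of_le_one_left hM.le ?_
        rw [one_div, inv_mul_le_iff₀ hε]
        linarith

theorem neighborhoodVolume_pos (d : ℕ) {ε : ℝ} (hε : 0 < ε) : 0 < neighborhoodVolume d ε := by
  have : 0 < (volume : Measure (Space d)).real (Metric.ball 0 1) :=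
    ENNReal.toReal_pos (Metric.measure_ball_pos _ _ one_pos).ne' measure_ball_lt_top.ne
  unfold neighborhoodVolume
  positivity

theorem volume_ball_eq_neighborhoodVolume {ε : ℝ} (hε : 0 < ε) :
    volume (Metric.ball (0 : Space d) ε) = ENNReal.ofReal (neighborhoodVolume d ε) := by
  rw [Measure.addHaar_ball_of_pos _ _ hε, finrank_euclideanSpace, Fintype.card_fin,
    neighborhoodVolume, ENNReal.ofReal_mul (by positivity), Measure.real,
    ENNReal.ofReal_toReal measure_ball_lt_top.ne]

/-- An integral over all bonds of length less than `ε`, by the bond vector. -/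
theorem lintegral_lintegral_ball_swap {h : Space d × Space d → ENNReal} (hh : Measurable h)
    (ε : ℝ) :
    ∫⁻ x, ∫⁻ y in Metric.ball x ε, h (x, y) =
      ∫⁻ z in Metric.ball (0 : Space d) ε, ∫⁻ x, h (x, x + z) := by
  have h1 : ∀ x : Space d, ∫⁻ y in Metric.ball x ε, h (x, y) =
      ∫⁻ z in Metric.ball (0 : Space d) ε, h (x, x + z) := fun x => by
    rw [← lintegral_indicator measurableSet_ball, ← lintegral_indicator measurableSet_ball,
      ← lintegral_add_left_eq_self _ x]
    refine lintegral_congr fun z => ?_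
    by_cases hz : z ∈ Metric.ball (0 : Space d) ε
    · rw [indicator_of_mem hz, indicator_of_mem (by simpa using hz)]
    · rw [indicator_of_notMem hz, indicator_of_notMem (by simpa using hz)]
  simp only [h1]
  exact lintegral_lintegral_swap
    (hh.comp (by fun_prop : Measurable fun p : Space d × Space d => (p.1, p.1 + p.2))).aemeasurable

/-- By Tonelli the energy is dominated by an average over bond vectors in the `ε`-ball; `V_d` is
exactly the volume of that ball. Working with extended norms avoids any integrability requirement.
-/
theorem PD_le_of_lintegral_le (hf : IsCohesivePotential f) (hJ : IsInfluence J M) {ε : ℝ}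
    (hε : 0 < ε) {u : Space d → Space d} (hu : Measurable u) (D : Set (Space d)) {Q : ENNReal}
    (hQ : Q ≠ ⊤)
    (h : ∀ z : Space d, z ≠ 0 → ‖z‖ < ε →
      ∫⁻ x, ENNReal.ofReal (potential f J ε (strain u x (x + z)) z) ≤ Q) (hd : 2 ≤ d) :
    PD f J D ε u ≤ Q.toReal := by
  have : Nontrivial (Space d) := by
    have : Nonempty (Fin d) := ⟨⟨0, by omega⟩⟩
    infer_instance
  have hV := neighborhoodVolume_pos d hε
  have hpe : ∀ x y : Space d, ‖potential f J ε (strain u x y) (y - x)‖ₑ =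
      ENNReal.ofReal (potential f J ε (strain u x y) (y - x)) := fun x y =>
    Real.enorm_of_nonneg (potential_nonneg hf hJ hε _ _)
  have key : ‖PD f J D ε u‖ₑ ≤ Q := calc
    ‖PD f J D ε u‖ₑ ≤ ∫⁻ x in D, ‖energyDensity f J ε u x‖ₑ := enorm_integral_le_lintegral_enorm _
    _ ≤ ∫⁻ x, ‖energyDensity f J ε u x‖ₑ := setLIntegral_le_lintegral _ _
    _ ≤ ∫⁻ x, ENNReal.ofReal (1 / neighborhoodVolume d ε) *
        ∫⁻ y in Metric.ball x ε, ENNReal.ofReal (potential f J ε (strain u x y) (y - x)) := by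
        refine lintegral_mono fun x => ?_
        rw [energyDensity, enorm_mul, Real.enorm_of_nonneg (by positivity)]
        simp only [← hpe]
        gcongr
        exact enorm_integral_le_lintegral_enorm _
    _ = ENNReal.ofReal (1 / neighborhoodVolume d ε) * ∫⁻ z in Metric.ball (0 : Space d) ε,
        ∫⁻ x, ENNReal.ofReal (potential f J ε (strain u x (x + z)) z) := by
        rw [lintegral_const_mul' _ _ ENNReal.ofReal_ne_top, lintegral_lintegral_ball_swap
          (h := fun p => ENNReal.ofReal (potential f J ε (strain u p.1 p.2) (p.2 - p.1)))
          (measurable_potential hf hJ hε hu).ennreal_ofReal]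
        simp only [add_sub_cancel_left]
    _ ≤ ENNReal.ofReal (1 / neighborhoodVolume d ε) * ∫⁻ _z in Metric.ball (0 : Space d) ε, Q := by
        refine mul_le_mul_right (lintegral_mono_ae ?_) _
        have hne : ∀ᵐ z : Space d, z ≠ 0 := by simp [ae_iff]
        filter_upwards [ae_restrict_mem measurableSet_ball, ae_restrict_of_ae hne] with z hz hz0
        exact h z hz0 (by simpa using hz)
    _ = Q := by
        rw [setLIntegral_const, volume_ball_eq_neighborhoodVolume hε, mul_comm Q, ← mul_assoc,
          ← ENNReal.ofReal_mul (by positivity), one_div_mul_cancel hV.ne', ENNReal.ofReal_one,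
          one_mul]
  calc PD f J D ε u ≤ ‖PD f J D ε u‖ := Real.le_norm_self _
    _ = (‖PD f J D ε u‖ₑ).toReal := (toReal_enorm _).symm
    _ ≤ Q.toReal := ENNReal.toReal_mono hQ key

/-- The peridynamic energy of a displacement of finite fracture energy is bounded uniformly in the
horizon. -/
theorem exists_PD_bound (hd : 2 ≤ d) (hD : IsOpen D) (hb : Bornology.IsBounded D) (hα : 0 < α)
    (hf : IsCohesivePotential f) (hJ : IsInfluence J M)
    {mu lam Gc : ℝ} (hmu : 0 < mu) (hlam : 0 < lam) (hGc : 0 < Gc) {w : L20 D α}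
    (hw : HasFiniteLEFM mu lam Gc D (field w)) :
    ∃ C : ℝ, ∀ ε, 0 < ε → PD f J D ε (field w) ≤ C := by
  obtain ⟨g, A, hg, hgi, hA, hinc⟩ := exists_increment_bound hD hb hα hmu hlam hGc hw
  obtain ⟨c, hc, hcA⟩ := exists_volume_tube_le hd
  obtain ⟨B, -, hB⟩ := hf.exists_bound
  refine ⟨_, fun ε hε => PD_le_of_lintegral_le hf hJ hε (measurable_field w) D ?_
    (fun z hz hzε => lintegral_potential_le hf hJ hε hB hg (V := c * surfaceMeasure d A)
      ((hcA A z hz).trans_eq (by ring)) hz hzε (hinc z)) hd⟩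
  exact ENNReal.mul_ne_top ENNReal.ofReal_ne_top (ENNReal.add_ne_top.2
    ⟨ENNReal.mul_ne_top ENNReal.ofReal_ne_top (ENNReal.mul_ne_top hc hA),
      ENNReal.mul_ne_top ENNReal.ofReal_ne_top hgi⟩)

end CohesiveDynamics
end
noncomputable section
namespace CohesiveDynamics
variable {d : ℕ} {D : Set (Space d)} {α : ℝ} {f : ℝ → ℝ} {J : ℝ → ℝ → ℝ} {M : ℝ}

/-! ### Integration over bonds -/

/-- The bonds `(x, y)` of length less than `ε`. -/
def bondSet (d : ℕ) (ε : ℝ) : Set (Space d × Space d) := {p | ‖p.2 - p.1‖ < ε}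

theorem measurableSet_bondSet (d : ℕ) (ε : ℝ) : MeasurableSet (bondSet d ε) :=
  measurableSet_lt (by fun_prop) measurable_const

/-- Lebesgue measure on the set of bonds. -/
def bondMeasure (d : ℕ) (ε : ℝ) : Measure (Space d × Space d) :=
  ((volume : Measure (Space d)).prod volume).restrict (bondSet d ε)

section

variable {F : Type*} [NormedAddCommGroup F] {ε : ℝ} {h : Space d × Space d → F}

theorem integrable_bondMeasure_iff :
    Integrable h (bondMeasure d ε) ↔
      Integrable ((bondSet d ε).indicator h) ((volume : Measure (Space d)).prod volume) :=
  (integrable_indicator_iff (measurableSet_bondSet d ε)).symm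

theorem indicator_bondSet (x : Space d) :
    (fun y => (bondSet d ε).indicator h (x, y)) =
      (Metric.ball x ε).indicator fun y => h (x, y) := by
  ext y
  by_cases hy : ‖y - x‖ < ε
  · rw [indicator_of_mem (show (x, y) ∈ bondSet d ε from hy),
      indicator_of_mem (by rwa [Metric.mem_ball, dist_eq_norm])]
  · rw [indicator_of_notMem (show (x, y) ∉ bondSet d ε from hy),
      indicator_of_notMem (by rwa [Metric.mem_ball, dist_eq_norm])]

theorem integrableOn_ball_of_bondMeasure (hh : Integrable h (bondMeasure d ε)) :
    ∀ᵐ x, IntegrableOn (fun y => h (x, y)) (Metric.ball x ε) := by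
  filter_upwards [(integrable_bondMeasure_iff.1 hh).prod_right_ae] with x hx
  rw [indicator_bondSet] at hx
  exact (integrable_indicator_iff measurableSet_ball).1 hx

theorem integral_bondMeasure [NormedSpace ℝ F] (hh : Integrable h (bondMeasure d ε)) :
    ∫ p, h p ∂(bondMeasure d ε) = ∫ x, ∫ y in Metric.ball x ε, h (x, y) := by
  rw [bondMeasure, ← integral_indicator (measurableSet_bondSet d ε),
    integral_prod _ (integrable_bondMeasure_iff.1 hh)]
  simp only [indicator_bondSet, integral_indicator measurableSet_ball]

theorem measurePreserving_swap_bondMeasure (d : ℕ) (ε : ℝ) :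
    MeasurePreserving Prod.swap (bondMeasure d ε) (bondMeasure d ε) := by
  have h1 : MeasurePreserving Prod.swap ((volume : Measure (Space d)).prod volume)
      ((volume : Measure (Space d)).prod volume) := Measure.measurePreserving_swap
  have h2 := h1.restrict_preimage (measurableSet_bondSet d ε)
  have h3 : Prod.swap ⁻¹' bondSet d ε = bondSet d ε := by
    ext p
    simp [bondSet, norm_sub_rev]
  rwa [h3] at h2

theorem integrable_swap_bondMeasure (hh : Integrable h (bondMeasure d ε)) :
    Integrable (fun p : Space d × Space d => h p.swap) (bondMeasure d ε) :=
  (measurePreserving_swap_bondMeasure d ε).integrable_comp_of_integrable hh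

theorem integral_swap_bondMeasure [NormedSpace ℝ F] :
    ∫ p, h p.swap ∂(bondMeasure d ε) = ∫ p, h p ∂(bondMeasure d ε) :=
  (measurePreserving_swap_bondMeasure d ε).integral_comp
    MeasurableEquiv.prodComm.measurableEmbedding h

end

/-- In polar coordinates the integrand becomes `r^{d-2}`, which is where `d ≥ 2` enters. -/
theorem integrableOn_inv_norm (hd : 2 ≤ d) (ε : ℝ) :
    IntegrableOn (fun z : Space d => ‖z‖⁻¹) (Metric.ball 0 ε) := by
  have : Nontrivial (Space d) := by
    have : Nonempty (Fin d) := ⟨⟨0, by omega⟩⟩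
    infer_instance
  rw [integrableOn_fun_norm_addHaar volume (f := fun r => r⁻¹)]
  have h1 : IntegrableOn (fun y : ℝ => y ^ (d - 2)) (Ioo 0 ε) :=
    ((continuous_pow (d - 2)).integrableOn_Icc (a := 0) (b := ε)).mono_set Ioo_subset_Icc_self
  refine h1.congr_fun (fun y hy => ?_) measurableSet_Ioo
  have hy0 : y ≠ 0 := hy.1.ne'
  simp only [finrank_euclideanSpace, Fintype.card_fin, smul_eq_mul]
  rw [show d - 1 = d - 2 + 1 by omega, pow_succ]
  field_simp

/-- The integral of `1/|z|` over the ball of radius `ε`. -/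
def rieszConst (d : ℕ) (ε : ℝ) : ℝ := ∫ z in Metric.ball (0 : Space d) ε, ‖z‖⁻¹

theorem indicator_inv_norm_eq {ε : ℝ} (a : Space d → ℝ) :
    (bondSet d ε).indicator (fun p => a p.1 * ‖p.2 - p.1‖⁻¹) =
      fun p => a p.1 * (Metric.ball (0 : Space d) ε).indicator (fun z => ‖z‖⁻¹) (p.2 - p.1) := by
  ext p
  by_cases hp : ‖p.2 - p.1‖ < ε
  · rw [indicator_of_mem (show p ∈ bondSet d ε from hp),
      indicator_of_mem (by rwa [Metric.mem_ball, dist_zero_right])]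
  · rw [indicator_of_notMem (show p ∉ bondSet d ε from hp),
      indicator_of_notMem (by rwa [Metric.mem_ball, dist_zero_right]), mul_zero]

theorem integrable_fst_mul_inv_norm (hd : 2 ≤ d) (ε : ℝ) {a : Space d → ℝ} (ha : Integrable a) :
    Integrable (fun p : Space d × Space d => a p.1 * ‖p.2 - p.1‖⁻¹) (bondMeasure d ε) := by
  rw [integrable_bondMeasure_iff, indicator_inv_norm_eq]
  have hk := (integrable_indicator_iff measurableSet_ball).2 (integrableOn_inv_norm hd ε)
  exact (ha.convolution_integrand (ContinuousLinearMap.mul ℝ ℝ) hk).swap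

theorem integrable_snd_mul_inv_norm (hd : 2 ≤ d) (ε : ℝ) {a : Space d → ℝ} (ha : Integrable a) :
    Integrable (fun p : Space d × Space d => a p.2 * ‖p.2 - p.1‖⁻¹) (bondMeasure d ε) := by
  have := integrable_swap_bondMeasure (integrable_fst_mul_inv_norm hd ε ha)
  simpa only [Prod.fst_swap, Prod.snd_swap, norm_sub_rev] using this

theorem integral_fst_mul_inv_norm (hd : 2 ≤ d) (ε : ℝ) {a : Space d → ℝ} (ha : Integrable a) :
    ∫ p, a p.1 * ‖p.2 - p.1‖⁻¹ ∂(bondMeasure d ε) = (∫ x, a x) * rieszConst d ε := by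
  rw [integral_bondMeasure (integrable_fst_mul_inv_norm hd ε ha)]
  have h1 : ∀ x : Space d, ∫ y in Metric.ball x ε, a x * ‖y - x‖⁻¹ = a x * rieszConst d ε := by
    intro x
    rw [integral_const_mul, rieszConst, ← integral_indicator measurableSet_ball,
      ← integral_indicator measurableSet_ball, ← integral_add_right_eq_self _ x]
    congr 2
    ext z
    by_cases hz : z ∈ Metric.ball (0 : Space d) ε
    · rw [indicator_of_mem hz, indicator_of_mem (by simpa using hz), add_sub_cancel_right]
    · rw [indicator_of_notMem hz, indicator_of_notMem (by simpa using hz)]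
  simp only [h1, integral_mul_const]

theorem integral_snd_mul_inv_norm (hd : 2 ≤ d) (ε : ℝ) {a : Space d → ℝ} (ha : Integrable a) :
    ∫ p, a p.2 * ‖p.2 - p.1‖⁻¹ ∂(bondMeasure d ε) = (∫ x, a x) * rieszConst d ε := by
  rw [← integral_fst_mul_inv_norm hd ε ha, ← integral_swap_bondMeasure]
  simp only [Prod.fst_swap, Prod.snd_swap, norm_sub_rev]

/-! ### Strains, energies and forces of square integrable fields -/

theorem norm_bond_le (x y : Space d) : ‖bond x y‖ ≤ 1 := by
  rw [bond, norm_smul, norm_inv, norm_norm]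
  exact inv_mul_le_one

theorem bond_symm (x y : Space d) : bond y x = -bond x y := by
  rw [bond, bond, norm_sub_rev, ← smul_neg, neg_sub]

theorem strain_symm (u : Space d → Space d) (x y : Space d) : strain u y x = strain u x y := by
  rw [strain, strain, bond_symm, norm_sub_rev, inner_neg_right, ← inner_neg_left, ← smul_neg,
    neg_sub]

theorem strain_add (u v : Space d → Space d) (x y : Space d) :
    strain (fun x => u x + v x) x y = strain u x y + strain v x y := by
  rw [strain, strain, strain, ← inner_add_left, ← smul_add, add_sub_add_comm]

theorem abs_strain_le (u : Space d → Space d) (x y : Space d) :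
    |strain u x y| ≤ (‖u x‖ + ‖u y‖) * ‖y - x‖⁻¹ := by
  refine (abs_real_inner_le_norm _ _).trans ?_
  refine (mul_le_of_le_one_right (norm_nonneg _) (norm_bond_le x y)).trans ?_
  rw [norm_smul, norm_inv, norm_norm, mul_comm, add_comm]
  gcongr
  exact norm_sub_le _ _

theorem norm_mul_strain (u : Space d → Space d) (x y : Space d) :
    ‖y - x‖ * strain u x y = inner ℝ (bond x y) (u y) - inner ℝ (bond x y) (u x) := by
  rw [← inner_sub_right, strain, real_inner_smul_left, real_inner_comm]
  rcases eq_or_ne (y - x) 0 with h | h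
  · simp [bond, h]
  · rw [← mul_assoc, mul_inv_cancel₀ (norm_ne_zero_iff.2 h), one_mul]

theorem norm_mul_strain_sq_le (u : Space d → Space d) (x y : Space d) :
    ‖y - x‖ * strain u x y ^ 2 ≤
      2 * (‖u x‖ ^ 2 * ‖y - x‖⁻¹) + 2 * (‖u y‖ ^ 2 * ‖y - x‖⁻¹) := by
  have h1 := abs_strain_le u x y
  have h2 : strain u x y ^ 2 ≤ ((‖u x‖ + ‖u y‖) * ‖y - x‖⁻¹) ^ 2 := by
    rw [← sq_abs]
    gcongr
  have h3 : ‖y - x‖ * ((‖u x‖ + ‖u y‖) * ‖y - x‖⁻¹) ^ 2 =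
      (‖u x‖ + ‖u y‖) ^ 2 * ‖y - x‖⁻¹ := by
    rcases eq_or_ne (‖y - x‖) 0 with h | h
    · simp [h]
    · field_simp
  calc ‖y - x‖ * strain u x y ^ 2 ≤ (‖u x‖ + ‖u y‖) ^ 2 * ‖y - x‖⁻¹ := by
        rw [← h3]; gcongr
    _ ≤ (2 * (‖u x‖ ^ 2 + ‖u y‖ ^ 2)) * ‖y - x‖⁻¹ := by
        gcongr
        exact add_sq_le
    _ = _ := by ring

theorem potential_le_norm (hf : IsCohesivePotential f) (hJ : IsInfluence J M) {ε : ℝ} (hε : 0 < ε)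
    (S : ℝ) (z : Space d) :
    potential f J ε S z ≤ 1 / ε * M * derivWithin f (Ici 0) 0 * (‖z‖ * S ^ 2) := by
  rw [potential_eq hf, mul_assoc _ (derivWithin f (Ici 0) 0)]
  have h0 : 0 ≤ ‖z‖ * S ^ 2 := by positivity
  have := hJ.le_bound hε (norm_nonneg z)
  have := hf.nonneg h0
  have := hf.le_linear h0
  have := hJ.bound_pos
  gcongr

theorem abs_forcePerLength_le (hf : IsCohesivePotential f) (hJ : IsInfluence J M) {ε : ℝ}
    (hε : 0 < ε) (S : ℝ) (z : Space d) :
    |forcePerLength f J ε S z| ≤ 2 * (1 / ε * M * derivWithin f (Ici 0) 0) * |S| := by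
  rw [forcePerLength_eq hf]
  have h0 : 0 ≤ ‖z‖ * S ^ 2 := by positivity
  have h1 := hJ.le_bound hε (norm_nonneg z)
  have h2 := hJ.nonneg' hε (norm_nonneg z)
  have h3 := hf.derivWithin_nonneg h0
  have h4 := hf.derivWithin_le h0
  have h6 := hf.slope_pos
  have h5 : ‖z‖⁻¹ * ‖z‖ ≤ 1 := inv_mul_le_one
  have hM := hJ.bound_pos
  rw [abs_mul (1 / ε * J ε ‖z‖), abs_mul (2 * derivWithin f (Ici 0) (‖z‖ * S ^ 2)),
    abs_mul (‖z‖⁻¹ * ‖z‖), abs_of_nonneg (show 0 ≤ 1 / ε * J ε ‖z‖ by positivity),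
    abs_of_nonneg (show 0 ≤ 2 * derivWithin f (Ici 0) (‖z‖ * S ^ 2) by positivity),
    abs_of_nonneg (show 0 ≤ ‖z‖⁻¹ * ‖z‖ by positivity)]
  calc 1 / ε * J ε ‖z‖ * (2 * derivWithin f (Ici 0) (‖z‖ * S ^ 2) * (‖z‖⁻¹ * ‖z‖ * |S|))
      ≤ 1 / ε * M * (2 * derivWithin f (Ici 0) 0 * (1 * |S|)) := by gcongr
    _ = _ := by ring

theorem forcePerLength_symm (S ε : ℝ) (x y : Space d) :
    forcePerLength f J ε S (x - y) = forcePerLength f J ε S (y - x) := by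
  simp only [forcePerLength, potentialPerLength, norm_sub_rev x y]

end CohesiveDynamics
end
-- Semiconcavity of the peridynamic energy on square integrable fields
noncomputable section
namespace CohesiveDynamics
variable {d : ℕ} {D : Set (Space d)} {α : ℝ} {f : ℝ → ℝ} {J : ℝ → ℝ → ℝ} {M : ℝ}

/-- The modulus of the quadratic bound on the bond energy. -/
def bondModulus (f : ℝ → ℝ) (M ε : ℝ) : ℝ := 1 / ε * M * derivWithin f (Ici 0) 0

theorem bondModulus_nonneg (hf : IsCohesivePotential f) (hJ : IsInfluence J M) {ε : ℝ}
    (hε : 0 < ε) : 0 ≤ bondModulus f M ε := by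
  have := hJ.bound_pos
  have := hf.slope_pos
  unfold bondModulus
  positivity

theorem measurable_quadratic {u : Space d → Space d} (hu : Measurable u) :
    Measurable fun p : Space d × Space d => ‖p.2 - p.1‖ * strain u p.1 p.2 ^ 2 :=
  (by fun_prop : Measurable fun p : Space d × Space d => ‖p.2 - p.1‖).mul
    ((measurable_strain hu).pow_const 2)

theorem integrable_quadratic (hd : 2 ≤ d) (ε : ℝ) {u : Space d → Space d} (hu : Measurable u)
    (hu2 : Integrable fun x => ‖u x‖ ^ 2) :
    Integrable (fun p : Space d × Space d => ‖p.2 - p.1‖ * strain u p.1 p.2 ^ 2)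
      (bondMeasure d ε) := by
  refine Integrable.mono' (((integrable_fst_mul_inv_norm hd ε hu2).const_mul 2).add
    ((integrable_snd_mul_inv_norm hd ε hu2).const_mul 2))
    (measurable_quadratic hu).aestronglyMeasurable (Eventually.of_forall fun p => ?_)
  rw [Real.norm_of_nonneg (by positivity)]
  exact norm_mul_strain_sq_le u p.1 p.2

/-- Bounds the quadratic error by the `L²` norm. The constant depends on `ε`, which is harmless: it
serves only to differentiate the energy in time at fixed `ε`. -/
theorem integral_quadratic_le (hd : 2 ≤ d) (ε : ℝ) {u : Space d → Space d} (hu : Measurable u)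
    (hu2 : Integrable fun x => ‖u x‖ ^ 2) :
    ∫ p, ‖p.2 - p.1‖ * strain u p.1 p.2 ^ 2 ∂(bondMeasure d ε) ≤
      4 * rieszConst d ε * ∫ x, ‖u x‖ ^ 2 := by
  have i1 := (integrable_fst_mul_inv_norm hd ε hu2).const_mul 2
  have i2 := (integrable_snd_mul_inv_norm hd ε hu2).const_mul 2
  refine (integral_mono (integrable_quadratic hd ε hu hu2) (i1.add i2) fun p =>
    norm_mul_strain_sq_le u p.1 p.2).trans_eq ?_
  simp only [Pi.add_apply]
  rw [integral_add i1 i2, integral_const_mul, integral_const_mul,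
    integral_fst_mul_inv_norm hd ε hu2, integral_snd_mul_inv_norm hd ε hu2]
  ring

theorem integrable_potential (hd : 2 ≤ d) (hf : IsCohesivePotential f) (hJ : IsInfluence J M)
    {ε : ℝ} (hε : 0 < ε) {u : Space d → Space d} (hu : Measurable u)
    (hu2 : Integrable fun x => ‖u x‖ ^ 2) :
    Integrable (fun p : Space d × Space d => potential f J ε (strain u p.1 p.2) (p.2 - p.1))
      (bondMeasure d ε) := by
  refine Integrable.mono' ((integrable_quadratic hd ε hu hu2).const_mul (bondModulus f M ε))
    (measurable_potential hf hJ hε hu).aestronglyMeasurable (Eventually.of_forall fun p => ?_)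
  rw [Real.norm_of_nonneg (potential_nonneg hf hJ hε _ _)]
  exact potential_le_norm hf hJ hε _ _

theorem measurable_force_smul_bond (hf : IsCohesivePotential f) (hJ : IsInfluence J M) {ε : ℝ}
    (hε : 0 < ε) {u : Space d → Space d} (hu : Measurable u) :
    Measurable fun p : Space d × Space d =>
      forcePerLength f J ε (strain u p.1 p.2) (p.2 - p.1) • bond p.1 p.2 :=
  (measurable_forcePerLength hf hJ hε hu).smul measurable_bond

theorem norm_force_smul_bond_le (hf : IsCohesivePotential f) (hJ : IsInfluence J M) {ε : ℝ}
    (hε : 0 < ε) (u : Space d → Space d) (x y : Space d) :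
    ‖forcePerLength f J ε (strain u x y) (y - x) • bond x y‖ ≤
      2 * bondModulus f M ε * ((‖u x‖ + ‖u y‖) * ‖y - x‖⁻¹) := by
  have := bondModulus_nonneg hf hJ hε
  rw [norm_smul]
  refine (mul_le_of_le_one_right (norm_nonneg _) (norm_bond_le x y)).trans ?_
  refine (abs_forcePerLength_le hf hJ hε _ _).trans ?_
  change 2 * bondModulus f M ε * _ ≤ _
  gcongr
  exact abs_strain_le u x y

theorem integrable_force_smul_bond (hd : 2 ≤ d) (hf : IsCohesivePotential f)
    (hJ : IsInfluence J M) {ε : ℝ} (hε : 0 < ε) {u : Space d → Space d} (hu : Measurable u)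
    (hu1 : Integrable u) :
    Integrable (fun p : Space d × Space d =>
      forcePerLength f J ε (strain u p.1 p.2) (p.2 - p.1) • bond p.1 p.2) (bondMeasure d ε) := by
  refine Integrable.mono' (((integrable_fst_mul_inv_norm hd ε hu1.norm).add
    (integrable_snd_mul_inv_norm hd ε hu1.norm)).const_mul (2 * bondModulus f M ε))
    (measurable_force_smul_bond hf hJ hε hu).aestronglyMeasurable (Eventually.of_forall fun p => ?_)
  refine (norm_force_smul_bond_le hf hJ hε u p.1 p.2).trans_eq ?_
  simp only [Pi.add_apply]
  ring

/-- The power density of the bond forces of `u` in the velocity field `v`. -/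
def bondPower (f : ℝ → ℝ) (J : ℝ → ℝ → ℝ) (ε : ℝ) (u v : Space d → Space d)
    (p : Space d × Space d) : ℝ :=
  inner ℝ (forcePerLength f J ε (strain u p.1 p.2) (p.2 - p.1) • bond p.1 p.2) (v p.1)

theorem integrable_bondPower (hd : 2 ≤ d) (hf : IsCohesivePotential f)
    (hJ : IsInfluence J M) {ε : ℝ} (hε : 0 < ε) {u v : Space d → Space d} (hu : Measurable u)
    (hv : Measurable v) (hu2 : Integrable fun x => ‖u x‖ ^ 2)
    (hv2 : Integrable fun x => ‖v x‖ ^ 2) :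
    Integrable (bondPower f J ε u v) (bondMeasure d ε) := by
  have hmod := bondModulus_nonneg hf hJ hε
  refine Integrable.mono' (((integrable_fst_mul_inv_norm hd ε (hu2.add (hv2.const_mul 2))).add
    (integrable_snd_mul_inv_norm hd ε hu2)).const_mul (bondModulus f M ε))
    ((measurable_force_smul_bond hf hJ hε hu).inner
      (hv.comp measurable_fst)).aestronglyMeasurable
    (Eventually.of_forall fun p => ?_)
  refine (norm_inner_le_norm _ _).trans ((mul_le_mul_of_nonneg_right
    (norm_force_smul_bond_le hf hJ hε u p.1 p.2) (norm_nonneg _)).trans ?_)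
  simp only [Pi.add_apply]
  have h1 : 2 * ((‖u p.1‖ + ‖u p.2‖) * ‖v p.1‖) ≤
      ‖u p.1‖ ^ 2 + 2 * ‖v p.1‖ ^ 2 + ‖u p.2‖ ^ 2 := by
    nlinarith [sq_nonneg (‖u p.1‖ - ‖v p.1‖), sq_nonneg (‖u p.2‖ - ‖v p.1‖)]
  calc 2 * bondModulus f M ε * ((‖u p.1‖ + ‖u p.2‖) * ‖p.2 - p.1‖⁻¹) * ‖v p.1‖
      = bondModulus f M ε * (2 * ((‖u p.1‖ + ‖u p.2‖) * ‖v p.1‖) * ‖p.2 - p.1‖⁻¹) := by ring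
    _ ≤ bondModulus f M ε *
        ((‖u p.1‖ ^ 2 + 2 * ‖v p.1‖ ^ 2 + ‖u p.2‖ ^ 2) * ‖p.2 - p.1‖⁻¹) := by gcongr
    _ = _ := by ring

/-- Action and reaction: the force at the other end of the bond is opposite. Symmetrizing over the
two ends produces the factor `2` in `∇PD`. -/
theorem bondPower_swap (f : ℝ → ℝ) (J : ℝ → ℝ → ℝ) (ε : ℝ) (u v : Space d → Space d)
    (p : Space d × Space d) :
    bondPower f J ε u v p.swap =
      -inner ℝ (forcePerLength f J ε (strain u p.1 p.2) (p.2 - p.1) • bond p.1 p.2) (v p.2) := by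
  simp only [bondPower, Prod.fst_swap, Prod.snd_swap]
  rw [forcePerLength_symm, strain_symm, bond_symm, smul_neg, inner_neg_left]

/-- The bond energy is semiconcave on square integrable displacements. -/
theorem integral_potential_add_le (hd : 2 ≤ d) (hf : IsCohesivePotential f)
    (hJ : IsInfluence J M) {ε : ℝ} (hε : 0 < ε) {u v : Space d → Space d} (hu : Measurable u)
    (hv : Measurable v) (hu2 : Integrable fun x => ‖u x‖ ^ 2)
    (hv2 : Integrable fun x => ‖v x‖ ^ 2)
    (huv2 : Integrable fun x => ‖u x + v x‖ ^ 2) :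
    ∫ p, potential f J ε (strain (fun x => u x + v x) p.1 p.2) (p.2 - p.1) ∂(bondMeasure d ε) ≤
      ∫ p, potential f J ε (strain u p.1 p.2) (p.2 - p.1) ∂(bondMeasure d ε) +
        -2 * ∫ p, bondPower f J ε u v p ∂(bondMeasure d ε) +
        bondModulus f M ε * (4 * rieszConst d ε * ∫ x, ‖v x‖ ^ 2) := by
  have i1 := integrable_potential hd hf hJ hε hu hu2
  have i2 := integrable_bondPower hd hf hJ hε hu hv hu2 hv2
  have i2' := integrable_swap_bondMeasure i2
  have i3 := (integrable_quadratic hd ε hv hv2).const_mul (bondModulus f M ε)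
  have i12 : Integrable (fun p => potential f J ε (strain u p.1 p.2) (p.2 - p.1) +
      (-bondPower f J ε u v p.swap - bondPower f J ε u v p)) (bondMeasure d ε) :=
    i1.add (i2'.neg.sub i2)
  have i22 : Integrable (fun p => -bondPower f J ε u v p.swap - bondPower f J ε u v p)
      (bondMeasure d ε) := i2'.neg.sub i2
  have i2n : Integrable (fun p => -bondPower f J ε u v p.swap) (bondMeasure d ε) := i2'.neg
  have key := integral_mono (integrable_potential hd hf hJ hε (hu.add hv) huv2) (i12.add i3)
    (fun p => by
      -- The linear term splits as `F e · v(y) - F e · v(x)`, which is minus the bond power at the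
      -- two ends.
      have h1 := potential_le hf hJ hε (strain u p.1 p.2) (strain v p.1 p.2) (p.2 - p.1)
      rw [norm_mul_strain] at h1
      simp only [Pi.add_apply, bondPower_swap]
      simp only [bondPower, neg_neg, real_inner_smul_left]
      rw [show strain (u + v) p.1 p.2 = strain (fun x => u x + v x) p.1 p.2 from rfl, strain_add]
      refine h1.trans_eq ?_
      rw [bondModulus]
      ring)
  simp only [Pi.add_apply] at key
  rw [integral_add i12 i3, integral_add i1 i22, integral_sub i2n i2, integral_neg,
    integral_swap_bondMeasure, integral_const_mul] at key
  have h2 := mul_le_mul_of_nonneg_left (integral_quadratic_le hd ε hv hv2)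
    (bondModulus_nonneg hf hJ hε)
  refine key.trans ?_
  linarith

/-! ### The peridynamic energy as an integral over bonds -/

/-- A neighbour `y ∈ D_s` of `x` within `ε ≤ α` would put `x` in `D`. So for almost every `x`
outside `D` the displacement vanishes at both ends of almost every bond, and `PD` may be integrated
over all bonds of the space, which makes it symmetric in the two ends. -/
theorem energyDensity_ae_eq_zero (hf : IsCohesivePotential f) {ε : ℝ} (hεα : ε ≤ α)
    (w : L20 D α) : ∀ᵐ x, x ∉ D → energyDensity f J ε (field w) x = 0 := by
  filter_upwards [field_ae_eq_zero w] with x hx hxD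
  have h0 : field w x = 0 := hx fun h => hxD h.1
  rw [energyDensity]
  convert mul_zero _
  refine integral_eq_zero_of_ae ?_
  filter_upwards [ae_restrict_mem measurableSet_ball, ae_restrict_of_ae (field_ae_eq_zero w)]
    with y hy hwy
  have hy0 : field w y = 0 := hwy fun h => hxD <| ball_subset_of_mem_interiorPart h <|
    Metric.ball_subset_ball hεα (by rwa [Metric.mem_ball, dist_comm])
  simp [potential_eq hf, strain, h0, hy0, hf.map_zero]

theorem integrable_norm_sq_field (w : L20 D α) : Integrable fun x => ‖field w x‖ ^ 2 :=
  (memLp_field w).integrable_norm_pow (by norm_num)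

theorem PD_eq_integral_bondMeasure (hd : 2 ≤ d)
    (hf : IsCohesivePotential f) (hJ : IsInfluence J M)
    {ε : ℝ} (hε : 0 < ε) (hεα : ε ≤ α) (w : L20 D α) :
    PD f J D ε (field w) = 1 / neighborhoodVolume d ε *
      ∫ p, potential f J ε (strain (field w) p.1 p.2) (p.2 - p.1) ∂(bondMeasure d ε) := by
  rw [integral_bondMeasure (integrable_potential hd hf hJ hε (measurable_field w)
    (integrable_norm_sq_field w)), ← integral_const_mul, PD]
  refine setIntegral_eq_integral_of_ae_compl_eq_zero ?_
  exact energyDensity_ae_eq_zero hf hεα w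

theorem integral_inner_gradPD (hd : 2 ≤ d) (hb : Bornology.IsBounded D)
    (hf : IsCohesivePotential f) (hJ : IsInfluence J M) {ε : ℝ} (hε : 0 < ε) (w : L20 D α)
    {v : Space d → Space d} (hv : Measurable v) (hv2 : Integrable fun x => ‖v x‖ ^ 2) :
    ∫ x, inner ℝ (gradPD f J ε (field w) x) (v x) = 1 / neighborhoodVolume d ε *
      (-2 * ∫ p, bondPower f J ε (field w) v p ∂(bondMeasure d ε)) := by
  have i1 := integrable_force_smul_bond hd hf hJ hε (measurable_field w) (integrable_field hb w)
  rw [integral_bondMeasure (integrable_bondPower hd hf hJ hε (measurable_field w) hv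
    (integrable_norm_sq_field w) hv2), ← integral_const_mul, ← integral_const_mul]
  refine integral_congr_ae ?_
  filter_upwards [integrableOn_ball_of_bondMeasure i1] with x hx
  simp only [gradPD, bondPower]
  have h1 := integral_inner (𝕜 := ℝ) hx (v x)
  simp only [real_inner_comm _ (v x)] at h1
  rw [inner_neg_left, real_inner_smul_left, ← h1]
  ring

/-- The semiconcavity constant of the peridynamic energy. -/
def semiconcavityConst (d : ℕ) (f : ℝ → ℝ) (M ε : ℝ) : ℝ :=
  1 / neighborhoodVolume d ε * (bondModulus f M ε * (4 * rieszConst d ε))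

theorem norm_sub_sq_eq_integral (w₁ w₂ : L20 D α) :
    ‖w₂ - w₁‖ ^ 2 = ∫ x, ‖field w₂ x - field w₁ x‖ ^ 2 := by
  have h1 : ‖w₂ - w₁‖ ^ 2 = inner ℝ (w₂ - w₁) (w₂ - w₁) := (real_inner_self_eq_norm_sq _).symm
  rw [h1, Submodule.coe_inner, L2.inner_def]
  refine integral_congr_ae ?_
  filter_upwards [Lp.coeFn_sub (w₂ : Lp (Space d) 2 (volume : Measure (Space d))) w₁] with x hx
  rw [Submodule.coe_sub, hx, Pi.sub_apply, real_inner_self_eq_norm_sq]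
  rfl

theorem PD_le_semiconcave (hd : 2 ≤ d) (hb : Bornology.IsBounded D)
    (hf : IsCohesivePotential f) (hJ : IsInfluence J M) {ε : ℝ} (hε : 0 < ε) (hεα : ε ≤ α)
    (w₁ w₂ : L20 D α) :
    PD f J D ε (field w₂) ≤ PD f J D ε (field w₁) +
      (∫ x, inner ℝ (gradPD f J ε (field w₁) x) (field w₂ x - field w₁ x)) +
      semiconcavityConst d f M ε * ‖w₂ - w₁‖ ^ 2 := by
  have hm : Measurable fun x => field w₂ x - field w₁ x :=
    (measurable_field w₂).sub (measurable_field w₁)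
  have hi : Integrable fun x => ‖field w₂ x - field w₁ x‖ ^ 2 :=
    ((memLp_field w₂).sub (memLp_field w₁)).integrable_norm_pow (by norm_num)
  have key := integral_potential_add_le hd hf hJ hε (measurable_field w₁) hm
    (integrable_norm_sq_field w₁) hi (by simpa using integrable_norm_sq_field w₂)
  simp only [add_sub_cancel] at key
  have hV := neighborhoodVolume_pos d hε
  rw [PD_eq_integral_bondMeasure hd hf hJ hε hεα, PD_eq_integral_bondMeasure hd hf hJ hε hεα,
    integral_inner_gradPD hd hb hf hJ hε w₁ hm hi, norm_sub_sq_eq_integral, semiconcavityConst]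
  refine (mul_le_mul_of_nonneg_left key (by positivity)).trans_eq ?_
  ring

/-- Along solutions of the equation of motion the peridynamic force is the `L²` pairing with
`b - ρ u_tt`. -/
theorem integral_inner_gradPD_of_motion {ε ρ : ℝ} {w a b : L20 D α}
    (h : ∀ᵐ x : Space d, x ∈ interiorPart D α →
      ρ • field a x = -gradPD f J ε (field w) x + field b x) (w₂ : L20 D α) :
    ∫ x, inner ℝ (gradPD f J ε (field w) x) (field w₂ x - field w x) =
      inner ℝ (b - ρ • a) (w₂ - w) := by
  rw [Submodule.coe_inner, L2.inner_def]
  refine integral_congr_ae ?_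
  filter_upwards [h, field_ae_eq_zero w, field_ae_eq_zero w₂,
    Lp.coeFn_sub (w₂ : Lp (Space d) 2 (volume : Measure (Space d))) w,
    Lp.coeFn_sub (b : Lp (Space d) 2 (volume : Measure (Space d))) (ρ • a : L20 D α),
    Lp.coeFn_smul ρ (a : Lp (Space d) 2 (volume : Measure (Space d)))] with x h1 h2 h3 h4 h5 h6
  rw [Submodule.coe_sub, Submodule.coe_sub, h4, h5, Pi.sub_apply, Pi.sub_apply, Submodule.coe_smul,
    h6, Pi.smul_apply]
  change _ = inner ℝ (field b x - ρ • field a x) (field w₂ x - field w x)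
  -- The equation of motion is available only on `D_s`; elsewhere both displacements vanish, hence
  -- so does the integrand.
  by_cases hx : x ∈ interiorPart D α
  · rw [h1 hx]
    congr 1
    abel
  · rw [h2 hx, h3 hx]
    simp

end CohesiveDynamics
end
noncomputable section
namespace CohesiveDynamics

/-! ### Energy balance for semiconcave energies -/

section EnergyBalance

variable {H : Type*} [NormedAddCommGroup H] [InnerProductSpace ℝ H]

/-- If the increments of `P` along a curve are bounded by a continuous force up to a quadratic
error, then `P` is differentiable along the curve. -/
theorem hasDerivWithinAt_of_semiconcave {s : Set ℝ} {u F : ℝ → H} {P : ℝ → ℝ} {κ : ℝ}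
    (hF : ContinuousOn F s)
    (h : ∀ r ∈ s, ∀ t ∈ s, P r ≤ P t + inner ℝ (F t) (u r - u t) + κ * ‖u r - u t‖ ^ 2)
    {t : ℝ} (ht : t ∈ s) {u' : H} (hu : HasDerivWithinAt u u' s t) :
    HasDerivWithinAt P (inner ℝ (F t) u') s t := by
  have hg : HasDerivWithinAt (fun r => inner ℝ (F t) (u r)) (inner ℝ (F t) u') s t := by
    simpa using (hasDerivWithinAt_const t s (F t)).inner ℝ hu
  have hO : (fun r => u r - u t) =O[𝓝[s] t] fun r => r - t := hu.differentiableWithinAt.isBigO_sub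
  have ho : (fun r => |κ| * ‖u r - u t‖ + ‖F r - F t‖) =o[𝓝[s] t] fun _ => (1 : ℝ) := by
    rw [Asymptotics.isLittleO_one_iff]
    have h1 : Tendsto (fun r => u r - u t) (𝓝[s] t) (𝓝 0) := by
      simpa using (hu.continuousWithinAt.tendsto.sub_const (u t))
    have h2 : Tendsto (fun r => F r - F t) (𝓝[s] t) (𝓝 0) := by
      simpa using ((hF t ht).tendsto.sub_const (F t))
    simpa using (h1.norm.const_mul |κ|).add h2.norm
  have hd : HasDerivWithinAt (fun r => P r - inner ℝ (F t) (u r)) 0 s t := by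
    rw [hasDerivWithinAt_iff_isLittleO]
    have hprod := ho.mul_isBigO hO.norm_left
    simp only [one_mul] at hprod
    refine Asymptotics.IsBigO.trans_isLittleO (Asymptotics.IsBigO.of_bound 1 ?_) hprod
    filter_upwards [self_mem_nhdsWithin] with r hr
    -- The hypothesis from `t` to `r` bounds the increment of `P` above; from `r` to `t` it bounds
    -- it below, with `F r` in place of `F t`. Exchanging them costs `‖F r - F t‖ ‖u r - u t‖`,
    -- which is `o(r - t)` by continuity of `F`.
    have h1 := h r hr t ht
    have h2 := h t ht r hr
    have h3 : inner ℝ (F r) (u t - u r) = -inner ℝ (F t) (u r - u t) -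
        inner ℝ (F r - F t) (u r - u t) := by
      rw [inner_sub_left, ← neg_sub (u r) (u t), inner_neg_right]
      ring
    have h4 := (abs_le.1 (abs_real_inner_le_norm (F r - F t) (u r - u t))).1
    have h4' := (abs_le.1 (abs_real_inner_le_norm (F r - F t) (u r - u t))).2
    have h5 : κ * ‖u r - u t‖ ^ 2 ≤ |κ| * ‖u r - u t‖ ^ 2 := by gcongr; exact le_abs_self κ
    rw [norm_sub_rev (u t), h3] at h2
    have h6 : 0 ≤ ‖F r - F t‖ * ‖u r - u t‖ := by positivity
    have h7 : inner ℝ (F t) (u r - u t) = inner ℝ (F t) (u r) - inner ℝ (F t) (u t) :=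
      inner_sub_right _ _ _
    rw [smul_zero, sub_zero, one_mul, Real.norm_eq_abs, Real.norm_of_nonneg (by positivity),
      add_mul, mul_assoc, ← sq, abs_le]
    constructor <;> linarith
  have := hd.add hg
  rw [zero_add] at this
  exact this.congr_deriv rfl |>.congr (fun r _ => by simp) (by simp)

/-- Grönwall's estimate for the total energy. -/
theorem energy_le_of_hasDerivWithinAt {T ρ B : ℝ} (hρ : 0 < ρ) {P : ℝ → ℝ} {v v' b : ℝ → H}
    (hP0 : ∀ t ∈ Icc 0 T, 0 ≤ P t)
    (hP : ∀ t ∈ Icc 0 T, HasDerivWithinAt P (inner ℝ (b t - ρ • v' t) (v t)) (Icc 0 T) t)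
    (hv : ∀ t ∈ Icc 0 T, HasDerivWithinAt v (v' t) (Icc 0 T) t)
    (hB : ∀ t ∈ Icc 0 T, ‖b t‖ ≤ B) {t : ℝ} (ht : t ∈ Icc 0 T) :
    P t + ρ / 2 * ‖v t‖ ^ 2 ≤ (P 0 + ρ / 2 * ‖v 0‖ ^ 2 + B ^ 2 / (2 * ρ)) * Real.exp T := by
  set E : ℝ → ℝ := fun t => P t + ρ / 2 * ‖v t‖ ^ 2 with hE
  have h0 : (0 : ℝ) ∈ Icc 0 T := ⟨le_rfl, ht.1.trans ht.2⟩
  have hEd : ∀ t ∈ Icc 0 T, HasDerivWithinAt E (inner ℝ (b t) (v t)) (Icc 0 T) t := fun t ht => by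
    -- The inertial term in the derivative of `P` cancels the derivative of the kinetic energy,
    -- leaving the power of the load.
    refine ((hP t ht).add ((hv t ht).norm_sq.const_mul (ρ / 2))).congr_deriv ?_
    rw [inner_sub_left, real_inner_smul_left, real_inner_comm (v t) (v' t)]
    ring
  have hE' : ∀ t ∈ Icc 0 T, inner ℝ (b t) (v t) ≤ E t + B ^ 2 / (2 * ρ) := fun t ht => by
    have h1 := (real_inner_le_norm (b t) (v t)).trans
      (mul_le_mul_of_nonneg_right (hB t ht) (norm_nonneg _))
    have h2 : B * ‖v t‖ ≤ ρ / 2 * ‖v t‖ ^ 2 + B ^ 2 / (2 * ρ) := by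
      have : ρ / 2 * ‖v t‖ ^ 2 + B ^ 2 / (2 * ρ) - B * ‖v t‖ =
          (ρ * ‖v t‖ - B) ^ 2 / (2 * ρ) := by
        field_simp
        ring
      rw [← sub_nonneg, this]
      positivity
    have := hP0 t ht
    simp only [hE]
    linarith
  set c := B ^ 2 / (2 * ρ)
  have hc : 0 ≤ c := by positivity
  have hGd : ∀ t ∈ Icc 0 T, HasDerivWithinAt (fun t => (E t + c) * Real.exp (-t))
      (inner ℝ (b t) (v t) * Real.exp (-t) + (E t + c) * (Real.exp (-t) * -1)) (Icc 0 T) t :=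
    fun t ht => ((hEd t ht).add_const c).mul
      ((hasDerivAt_neg t).exp.hasDerivWithinAt)
  -- Integrating factor: `E' ≤ E + c` makes `(E + c) e^{-t}` nonincreasing.
  have hanti : AntitoneOn (fun t => (E t + c) * Real.exp (-t)) (Icc 0 T) := by
    refine antitoneOn_of_hasDerivWithinAt_nonpos (convex_Icc 0 T)
      (fun t ht => (hGd t ht).continuousWithinAt)
      (fun t ht => (hGd t (interior_subset ht)).mono interior_subset) fun t ht => ?_
    nlinarith [hE' t (interior_subset ht), Real.exp_pos (-t)]
  have h1 := hanti h0 ht ht.1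
  simp only [neg_zero, Real.exp_zero, mul_one] at h1
  rw [Real.exp_neg, ← div_eq_mul_inv, div_le_iff₀ (Real.exp_pos t)] at h1
  have h2 : 0 ≤ E 0 + c := by
    have := hP0 0 h0
    simp only [hE]
    positivity
  calc E t ≤ E t + c := by linarith
    _ ≤ (E 0 + c) * Real.exp t := h1
    _ ≤ (E 0 + c) * Real.exp T := by gcongr; exact ht.2

end EnergyBalance

/-! ### Energy bound for cohesive evolutions -/

variable {d : ℕ} {D : Set (Space d)} {α : ℝ} {f : ℝ → ℝ} {J : ℝ → ℝ → ℝ} {M : ℝ}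

theorem PD_nonneg (hf : IsCohesivePotential f) (hJ : IsInfluence J M) {ε : ℝ} (hε : 0 < ε)
    (D : Set (Space d)) (u : Space d → Space d) : 0 ≤ PD f J D ε u := by
  have := neighborhoodVolume_pos d hε
  exact integral_nonneg fun x => mul_nonneg (by positivity)
    (integral_nonneg fun y => potential_nonneg hf hJ hε _ _)

theorem hasDerivWithinAt_velocity {F : Type*} [NormedAddCommGroup F] [NormedSpace ℝ F] {T : ℝ}
    {u : ℝ → F} (hu : DifferentiableOn ℝ u (Icc 0 T)) {t : ℝ} (ht : t ∈ Icc 0 T) :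
    HasDerivWithinAt u (velocity T u t) (Icc 0 T) t :=
  (hu t ht).hasDerivWithinAt

theorem contDiffOn_velocity {F : Type*} [NormedAddCommGroup F] [NormedSpace ℝ F] {T : ℝ}
    (hT : 0 < T) {u : ℝ → F} {n m : WithTop ℕ∞} (hu : ContDiffOn ℝ n u (Icc 0 T))
    (hmn : m + 1 ≤ n) : ContDiffOn ℝ m (velocity T u) (Icc 0 T) :=
  hu.derivWithin (uniqueDiffOn_Icc hT) hmn

/-- The energy of a cohesive evolution grows at most exponentially. -/
theorem IsCohesiveEvolution.energy_le (hd : 2 ≤ d) (hb : Bornology.IsBounded D)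
    (hf : IsCohesivePotential f) (hJ : IsInfluence J M) {ρ T : ℝ} (hρ : 0 < ρ) (hT : 0 < T)
    {b : ℝ → L20 D α} (hbc : ContinuousOn b (Icc 0 T)) {B : ℝ} (hB : ∀ t ∈ Icc 0 T, ‖b t‖ ≤ B)
    {u₀ v₀ : L20 D α} {ε : ℝ} (hε : 0 < ε) (hεα : ε ≤ α) {u : ℝ → L20 D α}
    (hu : IsCohesiveEvolution f J D α ρ T b u₀ v₀ ε u) {t : ℝ} (ht : t ∈ Icc 0 T) :
    PD f J D ε (field (u t)) + ρ / 2 * ‖velocity T u t‖ ^ 2 ≤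
      (PD f J D ε (field u₀) + ρ / 2 * ‖v₀‖ ^ 2 + B ^ 2 / (2 * ρ)) * Real.exp T := by
  have hv := contDiffOn_velocity (m := 1) hT hu.contDiff (by norm_num)
  have ha := contDiffOn_velocity (m := 0) hT hv (by norm_num)
  -- By the equation of motion the gradient pairs with displacement increments as `b - ρ u_tt`,
  -- which is continuous because `u` is `C²`; continuity of `∇PD` itself is never needed.
  have hF : ContinuousOn (fun t => b t - ρ • velocity T (velocity T u) t) (Icc 0 T) :=
    hbc.sub (ha.continuousOn.const_smul ρ)
  have hP : ∀ r ∈ Icc 0 T, ∀ t ∈ Icc 0 T, PD f J D ε (field (u r)) ≤ PD f J D ε (field (u t)) +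
      inner ℝ (b t - ρ • velocity T (velocity T u) t) (u r - u t) +
      semiconcavityConst d f M ε * ‖u r - u t‖ ^ 2 := fun r _ t ht => by
    rw [← integral_inner_gradPD_of_motion (hu.motion t ht)]
    exact PD_le_semiconcave hd hb hf hJ hε hεα (u t) (u r)
  have key := energy_le_of_hasDerivWithinAt hρ (P := fun t => PD f J D ε (field (u t)))
    (fun t _ => PD_nonneg hf hJ hε D _)
    (fun t ht => hasDerivWithinAt_of_semiconcave hF hP ht
      (hasDerivWithinAt_velocity (hu.contDiff.differentiableOn (by norm_num)) ht))
    (fun t ht => hasDerivWithinAt_velocity (hv.differentiableOn (by norm_num)) ht) hB ht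
  simpa only [hu.displacement_zero, hu.velocity_zero] using key

end CohesiveDynamics
end
theorem mainTheorem10 {d : ℕ} (hd : d = 2 ∨ d = 3)
    (D : Set (CohesiveDynamics.Space d)) (hDopen : IsOpen D) (hDbdd : Bornology.IsBounded D)
    (α : ℝ) (hα : 0 < α)
    (f : ℝ → ℝ) (hf : CohesiveDynamics.IsCohesivePotential f)
    (J : ℝ → ℝ → ℝ) (M : ℝ) (hJ : CohesiveDynamics.IsInfluence J M)
    (ρ : ℝ) (hρ : 0 < ρ)
    (mu lam Gc : ℝ) (hmu : 0 < mu) (hlam : 0 < lam) (hGc : 0 < Gc)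
    (T : ℝ) (hT : 0 < T)
    (b : ℝ → CohesiveDynamics.L20 D α) (hb : ContDiffOn ℝ 1 b (Set.Icc 0 T))
    (u₀ v₀ : CohesiveDynamics.L20 D α)
    (hu₀ : CohesiveDynamics.HasFiniteLEFM mu lam Gc D (CohesiveDynamics.field u₀)) :
    ∃ C : ℝ, 0 < C ∧
      ∀ ε : ℝ, 0 < ε → 2 * ε < α →
      ∀ u : ℝ → CohesiveDynamics.L20 D α,
        CohesiveDynamics.IsCohesiveEvolution f J D α ρ T b u₀ v₀ ε u →
        ∀ t ∈ Set.Icc 0 T,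
          CohesiveDynamics.PD f J D ε (CohesiveDynamics.field (u t)) +
            ρ / 2 * ‖CohesiveDynamics.velocity T u t‖ ^ 2 ≤ C := by
  have hd2 : 2 ≤ d := by omega
  obtain ⟨C₀, hC₀⟩ := CohesiveDynamics.exists_PD_bound hd2 hDopen hDbdd hα hf hJ hmu hlam hGc hu₀
  obtain ⟨B, hB⟩ := isCompact_Icc.exists_bound_of_continuousOn hb.continuousOn
  -- `C₀` comes with no sign; the maximum with `1` makes the constant positive.
  refine ⟨(max C₀ 1 + ρ / 2 * ‖v₀‖ ^ 2 + B ^ 2 / (2 * ρ)) * Real.exp T, by positivity,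
    fun ε hε hεα u hu t ht => ?_⟩
  refine (hu.energy_le hd2 hDbdd hf hJ hρ hT hb.continuousOn hB hε (by linarith) ht).trans ?_
  gcongr
  exact (hC₀ ε hε).trans (le_max_left _ _)
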